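/- Let $n\ge 2$. All manifolds are smooth, connected, Hausdorff, second countable and without boundary. **Abstract data.** Null metric hypersurface data $\{\mathcal N,\gamma,\ell,\ell^{(2)}\}$ consist of an $n$-manifold $\mathcal N$, a smooth symmetric $(0,2)$-tensor field $\gamma$ of signature $(0,+,\dots,+)$, a smooth covector field $\ell$ and a smooth function $\ell^{(2)}$ such that $$\mathcal A=\begin{pmatrix}\gamma_{ab}&\ell_a\\ \ell_b&\ell^{(2)}\end{pmatrix}$$ is non-degenerate everywhere. Its inverse has the form $\begin{pmatrix}P^{ab}&n^a\\ n^b&0\end{pmatrix}$, which defines a symmetric $(2,0)$-tensor field $P$ and a vector field $n$; put $F=\frac12 d\ell$, $s=F(n,\cdot)$, $U=\frac12\pounds_n\gamma$. For a nowhere zero smooth function $z$ and a smooth vector field $V$ on $\mathcal N$, the gauge transformation $\mathcal G_{(z,V)}$ acts by $$\gamma\mapsto\gamma,\qquad \ell\mapsto z(\ell+\gamma(V,\cdot)),\qquad \ell^{(2)}\mapsto z^2\big(\ell^{(2)}+2\ell(V)+\gamma(V,V)\big).$$ **Metric $\mathcal K$-tuples.** A metric $\mathcal K$-tuple $\{\mathcal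 N,\gamma,\ell,\ell^{(2)},\alpha,\mathfrak p,\mathfrak q\}$ is such data together with smooth functions $\alpha,\mathfrak p$ and a smooth covector field $\mathfrak q$ on $\mathcal N$, which transform as $$\alpha\mapsto z\alpha,\qquad \mathfrak q\mapsto z\big(\mathfrak q+2\alpha U(V,\cdot)\big),\qquad \mathfrak p\mapsto z^2\big(\mathfrak p+2\mathfrak q(V)+2\alpha U(V,V)\big).$$ Put $\bar\eta=\alpha n$. **Embeddedness.** The data $\{\mathcal N,\gamma,\ell,\ell^{(2)}\}$ are $(\phi,\xi)$-embedded in a Lorentzian $(n+1)$-manifold $(\mathcal M,g)$ if $\phi:\mathcal N\to\mathcal M$ is a smooth embedding and $\xi$ is a smooth vector field along $\phi$, everywhere transverse to $\phi(\mathcal N)$, with $\phi^\star g=\gamma$, $\phi^\star(g(\xi,\cdot))=\ell$, $\phi^\star(g(\xi,\xi))=\ell^{(2)}$. An *extension* of $\phi_\star\bar\eta$ is a smooth vector field $\eta$ on some open neighbourhood of $\phi(\mathcal N)$ in $\mathcal M$ with $\eta=\phi_\star\bar\eta$ on $\phi(\mathcal N)$. It *embeds* the metric $\mathcal K$-tuple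 (with respect to $\phi,\xi$) if the underlying data are $(\phi,\xi)$-embedded and $\mathcal K[\eta]=\pounds_\eta g$ satisfies $$\phi^\star\mathcal K[\eta]=2\alpha U,\qquad \phi^\star\big(\mathcal K[\eta](\xi,\cdot)\big)=\mathfrak q,\qquad \phi^\star\big(\mathcal K[\eta](\xi,\xi)\big)=\mathfrak p .$$ The metric $\mathcal K$-tuple is $(\phi,\xi)$-embedded in $(\mathcal M,g)$ if some extension of $\phi_\star\bar\eta$ embeds it. **Proposition.** Let $\{\mathcal N,\gamma,\ell,\ell^{(2)}\}$ be null metric hypersurface data that are $(\phi,\xi)$-embedded in a Lorentzian manifold $(\mathcal M,g)$. Let $\alpha,\mathfrak p$ be any smooth functions and $\mathfrak q$ any smooth covector field on $\mathcal N$, with the gauge laws above. Then: 1. The metric $\mathcal K$-tuple $\{\mathcal N,\gamma,\ell,\ell^{(2)},\alpha,\mathfrak p,\mathfrak q\}$ is $(\phi,\xi)$-embedded in $(\mathcal M,g)$. If $\phi(\mathcal N)$ is closed in $\mathcal M$, an embedding extension $\eta$ can be chosen as a smooth vector field on all of $\mathcal M$. 2. An extension $\eta$ of $\phi_\star\bar\eta$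 embeds the metric $\mathcal K$-tuple if and only if on $\phi(\mathcal N)$ $$\pounds_\xi\eta=(\mathfrak q-d\alpha)(n)\,\xi+\phi_\star\Big(\tfrac12\big(\mathfrak p-\alpha\, n(\ell^{(2)})\big)\,n+P\big(\mathfrak q-2\alpha s-d\alpha,\,\cdot\,\big)\Big).$$ Here $\pounds_\xi\eta$ at a point of $\phi(\mathcal N)$ is $[\Xi,\eta]$ for a smooth local extension $\Xi$ of $\xi$ off $\phi(\mathcal N)$; such $\Xi$ exist near every point, and the value does not depend on the choice of $\Xi$. 3. This is consistent with the gauge laws: if $\eta$ embeds the metric $\mathcal K$-tuple with respect to $(\phi,\xi)$, then for all gauge parameters $(z,V)$ the same $\eta$ is an extension of $\phi_\star$ of the transformed $\bar\eta$ and embeds the gauge-transformed metric $\mathcal K$-tuple with respect to $\phi$ and the rigging $z(\xi+\phi_\star V)$. -/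

import Mathlib

open Bundle FiberBundle VectorField Module
open scoped Manifold ContDiff Topology

noncomputable section

/-! ### Tensor calculus on manifolds -/

section Calculus

variable {E : Type*} [NormedAddCommGroup E] [NormedSpace ℝ E]
  {H : Type*} [TopologicalSpace H] (I : ModelWithCorners ℝ E H)
  {M : Type*} [TopologicalSpace M] [ChartedSpace H M] [IsManifold I ∞ M]

/-- A smooth vector field. -/
def IsSmoothVectorField (X : ∀ x : M, TangentSpace I x) : Prop :=
  ContMDiff I I.tangent ∞ (fun x ↦ (⟨x, X x⟩ : TangentBundle I M))

/-- A smooth covector field. -/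
def IsSmoothOneForm (θ : ∀ x : M, TangentSpace I x →L[ℝ] ℝ) : Prop :=
  ContMDiff I (I.prod 𝓘(ℝ, E →L[ℝ] ℝ)) ∞ (fun x ↦ TotalSpace.mk' (E →L[ℝ] ℝ) x (θ x))

/-- A smooth `(0,2)`-tensor field. -/
def IsSmoothTensor₂ (T : ∀ x : M, TangentSpace I x →L[ℝ] TangentSpace I x →L[ℝ] ℝ) : Prop :=
  ContMDiff I (I.prod 𝓘(ℝ, E →L[ℝ] E →L[ℝ] ℝ)) ∞
    (fun x ↦ TotalSpace.mk' (E →L[ℝ] E →L[ℝ] ℝ) x (T x))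

variable {I}

theorem IsSmoothOneForm.mdifferentiableAt_apply
    {θ : ∀ x : M, TangentSpace I x →L[ℝ] ℝ} (hθ : IsSmoothOneForm I θ)
    {V : ∀ x : M, TangentSpace I x} {x : M}
    (hV : MDifferentiableAt I I.tangent (fun y ↦ (⟨y, V y⟩ : TangentBundle I M)) x) :
    MDifferentiableAt I 𝓘(ℝ) (fun y ↦ θ y (V y)) x := by
  have h : MDifferentiableAt I (I.prod 𝓘(ℝ))
      (fun m ↦ TotalSpace.mk' ℝ (E := Bundle.Trivial M ℝ) m (θ m (V m))) x := by
    apply MDifferentiableAt.clm_bundle_apply (F₁ := E)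
    · exact ContMDiffAt.mdifferentiableAt (n := ∞) (hθ x) (by simp)
    · exact hV
  simp only [mdifferentiableAt_totalSpace] at h
  exact h.2

theorem IsSmoothTensor₂.mdifferentiableAt_apply
    {T : ∀ x : M, TangentSpace I x →L[ℝ] TangentSpace I x →L[ℝ] ℝ} (hT : IsSmoothTensor₂ I T)
    {V W : ∀ x : M, TangentSpace I x} {x : M}
    (hV : MDifferentiableAt I I.tangent (fun y ↦ (⟨y, V y⟩ : TangentBundle I M)) x)
    (hW : MDifferentiableAt I I.tangent (fun y ↦ (⟨y, W y⟩ : TangentBundle I M)) x) :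
    MDifferentiableAt I 𝓘(ℝ) (fun y ↦ T y (V y) (W y)) x := by
  have h : MDifferentiableAt I (I.prod 𝓘(ℝ))
      (fun m ↦ TotalSpace.mk' ℝ (E := Bundle.Trivial M ℝ) m (T m (V m) (W m))) x := by
    apply MDifferentiableAt.clm_bundle_apply₂ (F₁ := E) (F₂ := E)
    · exact ContMDiffAt.mdifferentiableAt (n := ∞) (hT x) (by simp)
    · exact hV
    · exact hW
  simp only [mdifferentiableAt_totalSpace] at h
  exact h.2

theorem IsSmoothOneForm.contMDiff_apply
    {θ : ∀ x : M, TangentSpace I x →L[ℝ] ℝ} (hθ : IsSmoothOneForm I θ)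
    {V : ∀ x : M, TangentSpace I x} (hV : IsSmoothVectorField I V) :
    ContMDiff I 𝓘(ℝ) ∞ (fun y ↦ θ y (V y)) := by
  have h : ContMDiff I (I.prod 𝓘(ℝ)) ∞
      (fun m ↦ TotalSpace.mk' ℝ (E := Bundle.Trivial M ℝ) m (θ m (V m))) :=
    ContMDiff.clm_bundle_apply (F₁ := E) hθ hV
  intro x
  have := h x
  simp only [contMDiffAt_totalSpace] at this
  exact this.2

theorem IsSmoothTensor₂.isSmoothOneForm_apply
    {T : ∀ x : M, TangentSpace I x →L[ℝ] TangentSpace I x →L[ℝ] ℝ} (hT : IsSmoothTensor₂ I T)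
    {V : ∀ x : M, TangentSpace I x} (hV : IsSmoothVectorField I V) :
    IsSmoothOneForm I (fun x ↦ T x (V x)) :=
  ContMDiff.clm_bundle_apply (F₁ := E) (F₂ := E →L[ℝ] ℝ)
    (E₂ := fun x : M ↦ TangentSpace I x →L[ℝ] ℝ) hT hV

variable (I)

/-- The expression `X(T(V,W)) - T([X,V],W) - T(V,[X,W])` at the point `x`. -/
def lieDerivAux (X : ∀ x : M, TangentSpace I x)
    (T : ∀ x : M, TangentSpace I x →L[ℝ] TangentSpace I x →L[ℝ] ℝ)
    (V W : ∀ x : M, TangentSpace I x) (x : M) : ℝ :=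
  mvfderiv I (fun y ↦ T y (V y) (W y)) x (X x) - T x (mlieBracket I X V x) (W x)
    - T x (V x) (mlieBracket I X W x)

/-- The expression `V(θ(W)) - W(θ(V)) - θ([V,W])` at the point `x`. -/
def extDerivAux (θ : ∀ x : M, TangentSpace I x →L[ℝ] ℝ)
    (V W : ∀ x : M, TangentSpace I x) (x : M) : ℝ :=
  mvfderiv I (fun y ↦ θ y (W y)) x (V x) - mvfderiv I (fun y ↦ θ y (V y)) x (W x)
    - θ x (mlieBracket I V W x)

variable {I} [FiniteDimensional ℝ E]

theorem lieDerivAux_tensorial₁ (X : ∀ x : M, TangentSpace I x)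
    {T : ∀ x : M, TangentSpace I x →L[ℝ] TangentSpace I x →L[ℝ] ℝ} (hT : IsSmoothTensor₂ I T)
    (x : M) (W : ∀ x : M, TangentSpace I x)
    (hW : MDifferentiableAt I I.tangent (fun y ↦ (⟨y, W y⟩ : TangentBundle I M)) x) :
    TensorialAt I E (lieDerivAux I X T · W x) x where
  smul {f V} hf hV := by
    have : CompleteSpace E := FiniteDimensional.complete ℝ E
    have h := hT.mdifferentiableAt_apply hV hW
    have e : (fun y ↦ T y ((f • V) y) (W y)) = fun y ↦ f y * T y (V y) (W y) := by
      ext y; simp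
    simp only [lieDerivAux]
    rw [e, mvfderiv_fun_mul hf h, mlieBracket_smul_right hf hV]
    simp
    ring
  add {V V'} hV hV' := by
    have : CompleteSpace E := FiniteDimensional.complete ℝ E
    have h := hT.mdifferentiableAt_apply hV hW
    have h' := hT.mdifferentiableAt_apply hV' hW
    have e : (fun y ↦ T y ((V + V') y) (W y)) = fun y ↦ T y (V y) (W y) + T y (V' y) (W y) := by
      ext y; simp
    simp only [lieDerivAux]
    rw [e, mvfderiv_fun_add h h', mlieBracket_add_right hV hV']
    simp
    ring

theorem lieDerivAux_tensorial₂ (X : ∀ x : M, TangentSpace I x)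
    {T : ∀ x : M, TangentSpace I x →L[ℝ] TangentSpace I x →L[ℝ] ℝ} (hT : IsSmoothTensor₂ I T)
    (x : M) (V : ∀ x : M, TangentSpace I x)
    (hV : MDifferentiableAt I I.tangent (fun y ↦ (⟨y, V y⟩ : TangentBundle I M)) x) :
    TensorialAt I E (lieDerivAux I X T V · x) x where
  smul {f W} hf hW := by
    have : CompleteSpace E := FiniteDimensional.complete ℝ E
    have h := hT.mdifferentiableAt_apply hV hW
    have e : (fun y ↦ T y (V y) ((f • W) y)) = fun y ↦ f y * T y (V y) (W y) := by
      ext y; simp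
    simp only [lieDerivAux]
    rw [e, mvfderiv_fun_mul hf h, mlieBracket_smul_right hf hW]
    simp
    ring
  add {W W'} hW hW' := by
    have : CompleteSpace E := FiniteDimensional.complete ℝ E
    have h := hT.mdifferentiableAt_apply hV hW
    have h' := hT.mdifferentiableAt_apply hV hW'
    have e : (fun y ↦ T y (V y) ((W + W') y)) = fun y ↦ T y (V y) (W y) + T y (V y) (W' y) := by
      ext y; simp
    simp only [lieDerivAux]
    rw [e, mvfderiv_fun_add h h', mlieBracket_add_right hW hW']
    simp
    ring

theorem extDerivAux_swap (θ : ∀ x : M, TangentSpace I x →L[ℝ] ℝ)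
    (V W : ∀ x : M, TangentSpace I x) (x : M) :
    extDerivAux I θ V W x = - extDerivAux I θ W V x := by
  simp only [extDerivAux]
  rw [mlieBracket_swap_apply (V := V)]
  simp
  ring

theorem extDerivAux_tensorial₂
    {θ : ∀ x : M, TangentSpace I x →L[ℝ] ℝ} (hθ : IsSmoothOneForm I θ)
    (x : M) (V : ∀ x : M, TangentSpace I x)
    (hV : MDifferentiableAt I I.tangent (fun y ↦ (⟨y, V y⟩ : TangentBundle I M)) x) :
    TensorialAt I E (extDerivAux I θ V · x) x where
  smul {f W} hf hW := by
    have : CompleteSpace E := FiniteDimensional.complete ℝ E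
    have h := hθ.mdifferentiableAt_apply hW
    have e : (fun y ↦ θ y ((f • W) y)) = fun y ↦ f y * θ y (W y) := by
      ext y; simp
    simp only [extDerivAux]
    rw [e, mvfderiv_fun_mul hf h, mlieBracket_smul_right hf hW]
    simp
    ring
  add {W W'} hW hW' := by
    have : CompleteSpace E := FiniteDimensional.complete ℝ E
    have h := hθ.mdifferentiableAt_apply hW
    have h' := hθ.mdifferentiableAt_apply hW'
    have e : (fun y ↦ θ y ((W + W') y)) = fun y ↦ θ y (W y) + θ y (W' y) := by
      ext y; simp
    simp only [extDerivAux]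
    rw [e, mvfderiv_fun_add h h', mlieBracket_add_right hW hW']
    simp
    ring

theorem extDerivAux_tensorial₁
    {θ : ∀ x : M, TangentSpace I x →L[ℝ] ℝ} (hθ : IsSmoothOneForm I θ)
    (x : M) (W : ∀ x : M, TangentSpace I x)
    (hW : MDifferentiableAt I I.tangent (fun y ↦ (⟨y, W y⟩ : TangentBundle I M)) x) :
    TensorialAt I E (extDerivAux I θ · W x) x where
  smul {f V} hf h_V := by
    rw [extDerivAux_swap, (extDerivAux_tensorial₂ hθ x W hW).smul hf h_V,
      extDerivAux_swap (V := V), smul_neg]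
  add {V V'} hV hV' := by
    rw [extDerivAux_swap, (extDerivAux_tensorial₂ hθ x W hW).add hV hV',
      extDerivAux_swap (V := V), extDerivAux_swap (V := V'), neg_add]

/-- The Lie derivative `£_X T` of a smooth `(0,2)`-tensor field along a vector field, as a
tensor at `x`: `(£_X T)(V,W) = X(T(V,W)) - T([X,V],W) - T(V,[X,W])`. -/
def lieDeriv (X : ∀ x : M, TangentSpace I x)
    {T : ∀ x : M, TangentSpace I x →L[ℝ] TangentSpace I x →L[ℝ] ℝ} (hT : IsSmoothTensor₂ I T)
    (x : M) : TangentSpace I x →L[ℝ] TangentSpace I x →L[ℝ] ℝ :=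
  TensorialAt.mkHom₂ (lieDerivAux I X T · · x) x
    (lieDerivAux_tensorial₁ X hT x) (lieDerivAux_tensorial₂ X hT x)

theorem lieDeriv_apply (X : ∀ x : M, TangentSpace I x)
    {T : ∀ x : M, TangentSpace I x →L[ℝ] TangentSpace I x →L[ℝ] ℝ} (hT : IsSmoothTensor₂ I T)
    {x : M} {V W : ∀ x : M, TangentSpace I x}
    (hV : MDifferentiableAt I I.tangent (fun y ↦ (⟨y, V y⟩ : TangentBundle I M)) x)
    (hW : MDifferentiableAt I I.tangent (fun y ↦ (⟨y, W y⟩ : TangentBundle I M)) x) :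
    lieDeriv X hT x (V x) (W x) =
      mvfderiv I (fun y ↦ T y (V y) (W y)) x (X x) - T x (mlieBracket I X V x) (W x)
        - T x (V x) (mlieBracket I X W x) :=
  TensorialAt.mkHom₂_apply _ _ hV hW

/-- The exterior derivative of a smooth covector field, as a tensor at `x`:
`dθ(V,W) = V(θ(W)) - W(θ(V)) - θ([V,W])`. -/
def extDerivForm {θ : ∀ x : M, TangentSpace I x →L[ℝ] ℝ} (hθ : IsSmoothOneForm I θ)
    (x : M) : TangentSpace I x →L[ℝ] TangentSpace I x →L[ℝ] ℝ :=
  TensorialAt.mkHom₂ (extDerivAux I θ · · x) x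
    (extDerivAux_tensorial₁ hθ x) (extDerivAux_tensorial₂ hθ x)

theorem extDerivForm_apply {θ : ∀ x : M, TangentSpace I x →L[ℝ] ℝ} (hθ : IsSmoothOneForm I θ)
    {x : M} {V W : ∀ x : M, TangentSpace I x}
    (hV : MDifferentiableAt I I.tangent (fun y ↦ (⟨y, V y⟩ : TangentBundle I M)) x)
    (hW : MDifferentiableAt I I.tangent (fun y ↦ (⟨y, W y⟩ : TangentBundle I M)) x) :
    extDerivForm hθ x (V x) (W x) =
      mvfderiv I (fun y ↦ θ y (W y)) x (V x) - mvfderiv I (fun y ↦ θ y (V y)) x (W x)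
        - θ x (mlieBracket I V W x) :=
  TensorialAt.mkHom₂_apply _ _ hV hW

end Calculus

/-! ### Lorentzian metrics -/

/-- A smooth Lorentzian metric, of signature `(-,+,…,+)`, on a `d`-dimensional manifold. -/
structure LorentzianMetric (d : ℕ) (M : Type*) [TopologicalSpace M]
    [ChartedSpace (EuclideanSpace ℝ (Fin d)) M] [IsManifold (𝓡 d) ∞ M] where
  /-- the metric tensor -/
  val : ∀ x : M, TangentSpace (𝓡 d) x →L[ℝ] TangentSpace (𝓡 d) x →L[ℝ] ℝ
  smooth : IsSmoothTensor₂ (𝓡 d) val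
  symm : ∀ (x : M) (v w : TangentSpace (𝓡 d) x), val x v w = val x w v
  signature : ∀ x : M, ∃ b : Basis (Fin d) ℝ (TangentSpace (𝓡 d) x),
    ∀ i j, val x (b i) (b j) = if i = j then (if (i : ℕ) = 0 then -1 else 1) else 0

/-! ### Null metric hypersurface data -/

/-- The square matrix with blocks `γ, ℓ, ℓ, ℓ⁽²⁾` on a vector space `T`, as the linear map
`(v, a) ↦ (γ(v,·) + a ℓ, ℓ(v) + a ℓ⁽²⁾)` from `T × ℝ` to `T* × ℝ`. -/
def blockMap {T : Type*} [AddCommGroup T] [Module ℝ T] [TopologicalSpace T]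
    (γ : T →L[ℝ] T →L[ℝ] ℝ) (ell : T →L[ℝ] ℝ) (ell2 : ℝ) :
    (T × ℝ) →L[ℝ] (T →L[ℝ] ℝ) × ℝ :=
  (γ.comp (ContinuousLinearMap.fst ℝ T ℝ) +
      (ContinuousLinearMap.snd ℝ T ℝ).smulRight ell).prod
    (ell.comp (ContinuousLinearMap.fst ℝ T ℝ) + ell2 • ContinuousLinearMap.snd ℝ T ℝ)

theorem blockMap_gauge_isInvertible {T : Type*} [NormedAddCommGroup T] [NormedSpace ℝ T]
    (γ : T →L[ℝ] T →L[ℝ] ℝ) (hγ : ∀ v w, γ v w = γ w v) (ell : T →L[ℝ] ℝ) (ell2 : ℝ)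
    (h : (blockMap γ ell ell2).IsInvertible) (z : ℝ) (hz : z ≠ 0) (V : T) :
    (blockMap γ (z • (ell + γ V)) (z ^ 2 * (ell2 + 2 * ell V + γ V V))).IsInvertible := by
  let R : (T × ℝ) →L[ℝ] T × ℝ :=
    ((ContinuousLinearMap.fst ℝ T ℝ) +
      (ContinuousLinearMap.snd ℝ T ℝ).smulRight (z • V)).prod
      (z • ContinuousLinearMap.snd ℝ T ℝ)
  let R' : (T × ℝ) →L[ℝ] T × ℝ :=
    ((ContinuousLinearMap.fst ℝ T ℝ) -
      (ContinuousLinearMap.snd ℝ T ℝ).smulRight V).prod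
      (z⁻¹ • ContinuousLinearMap.snd ℝ T ℝ)
  let ev : (T →L[ℝ] ℝ) →L[ℝ] ℝ := ContinuousLinearMap.apply ℝ ℝ V
  let L : ((T →L[ℝ] ℝ) × ℝ) →L[ℝ] (T →L[ℝ] ℝ) × ℝ :=
    (ContinuousLinearMap.fst ℝ _ ℝ).prod (z • (ContinuousLinearMap.snd ℝ _ ℝ +
      ev.comp (ContinuousLinearMap.fst ℝ _ ℝ)))
  let L' : ((T →L[ℝ] ℝ) × ℝ) →L[ℝ] (T →L[ℝ] ℝ) × ℝ :=
    (ContinuousLinearMap.fst ℝ _ ℝ).prod (z⁻¹ • ContinuousLinearMap.snd ℝ _ ℝ -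
      ev.comp (ContinuousLinearMap.fst ℝ _ ℝ))
  have hR : R.IsInvertible := by
    refine ContinuousLinearMap.IsInvertible.of_inverse (g := R') ?_ ?_
    · refine ContinuousLinearMap.ext fun x ↦ ?_
      have h : z⁻¹ * x.2 * z = x.2 := by field_simp
      ext
      · simp [R, R', smul_smul, h]
      · simp [R, R', hz]
    · refine ContinuousLinearMap.ext fun x ↦ ?_
      ext
      · simp [R, R', smul_smul, mul_comm]
      · simp [R, R', hz]
  have hL : L.IsInvertible := by
    refine ContinuousLinearMap.IsInvertible.of_inverse (g := L') ?_ ?_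
    · refine ContinuousLinearMap.ext fun x ↦ ?_
      ext
      · simp [L, L']
      · simp [L, L', ev]
        field_simp
        try ring
    · refine ContinuousLinearMap.ext fun x ↦ ?_
      ext
      · simp [L, L']
      · simp [L, L', ev]
        field_simp
        try ring
  have e : blockMap γ (z • (ell + γ V)) (z ^ 2 * (ell2 + 2 * ell V + γ V V))
      = L.comp ((blockMap γ ell ell2).comp R) := by
    refine ContinuousLinearMap.ext fun x ↦ ?_
    ext
    · simp [L, R, ev, blockMap]
      ring
    · simp [L, R, ev, blockMap, hγ V x.1]
      ring
  rw [e]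
  exact hL.comp (h.comp hR)

section Data

variable (n : ℕ) (N : Type*) [TopologicalSpace N]
  [ChartedSpace (EuclideanSpace ℝ (Fin n)) N] [IsManifold (𝓡 n) ∞ N]

/-- Null metric hypersurface data `{N, γ, ℓ, ℓ⁽²⁾}` on an `n`-manifold `N`. -/
structure NullMetricData where
  /-- the symmetric `(0,2)`-tensor `γ` -/
  γ : ∀ p : N, TangentSpace (𝓡 n) p →L[ℝ] TangentSpace (𝓡 n) p →L[ℝ] ℝ
  /-- the covector field `ℓ` -/
  ell : ∀ p : N, TangentSpace (𝓡 n) p →L[ℝ] ℝ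
  /-- the function `ℓ⁽²⁾` -/
  ell2 : N → ℝ
  smooth_γ : IsSmoothTensor₂ (𝓡 n) γ
  smooth_ell : IsSmoothOneForm (𝓡 n) ell
  smooth_ell2 : ContMDiff (𝓡 n) 𝓘(ℝ) ∞ ell2
  symm : ∀ (p : N) (v w : TangentSpace (𝓡 n) p), γ p v w = γ p w v
  signature : ∀ p : N, ∃ b : Basis (Fin n) ℝ (TangentSpace (𝓡 n) p),
    ∀ i j, γ p (b i) (b j) = if i = j then (if (i : ℕ) = 0 then 0 else 1) else 0
  nondegenerate : ∀ p : N, (blockMap (γ p) (ell p) (ell2 p)).IsInvertible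

/-- Gauge parameters: a nowhere vanishing smooth function `z` and a smooth vector field `V`. -/
structure GaugeParam where
  /-- the nowhere vanishing function -/
  z : N → ℝ
  /-- the vector field -/
  V : ∀ p : N, TangentSpace (𝓡 n) p
  smooth_z : ContMDiff (𝓡 n) 𝓘(ℝ) ∞ z
  z_ne_zero : ∀ p, z p ≠ 0
  smooth_V : IsSmoothVectorField (𝓡 n) V

variable {n N}

namespace NullMetricData

variable (D : NullMetricData n N)

/-- The vector field `n`: the inverse of the block matrix has block rows `(P, n)` and `(n, 0)`. -/
def nvec (p : N) : TangentSpace (𝓡 n) p :=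
  ((blockMap (D.γ p) (D.ell p) (D.ell2 p)).inverse (0, 1)).1

/-- The symmetric `(2,0)`-tensor `P`, as the map `θ ↦ P(θ,·)` from covectors to vectors. -/
def P (p : N) (θ : TangentSpace (𝓡 n) p →L[ℝ] ℝ) : TangentSpace (𝓡 n) p :=
  ((blockMap (D.γ p) (D.ell p) (D.ell2 p)).inverse (θ, 0)).1

/-- `F = ½ dℓ`. -/
def F (p : N) : TangentSpace (𝓡 n) p →L[ℝ] TangentSpace (𝓡 n) p →L[ℝ] ℝ :=
  (1 / 2 : ℝ) • extDerivForm D.smooth_ell p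

/-- `s = F(n,·)`. -/
def s (p : N) : TangentSpace (𝓡 n) p →L[ℝ] ℝ := D.F p (D.nvec p)

/-- `U = ½ £_n γ`. -/
def U (p : N) : TangentSpace (𝓡 n) p →L[ℝ] TangentSpace (𝓡 n) p →L[ℝ] ℝ :=
  (1 / 2 : ℝ) • lieDeriv D.nvec D.smooth_γ p

/-- The gauge transformation of null metric hypersurface data:
`γ ↦ γ`, `ℓ ↦ z (ℓ + γ(V,·))`, `ℓ⁽²⁾ ↦ z² (ℓ⁽²⁾ + 2 ℓ(V) + γ(V,V))`. -/
def gauge (G : GaugeParam n N) : NullMetricData n N where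
  γ := D.γ
  ell p := G.z p • (D.ell p + D.γ p (G.V p))
  ell2 p := G.z p ^ 2 * (D.ell2 p + 2 * D.ell p (G.V p) + D.γ p (G.V p) (G.V p))
  smooth_γ := D.smooth_γ
  smooth_ell := ContMDiff.smul_section G.smooth_z
    (ContMDiff.add_section D.smooth_ell (D.smooth_γ.isSmoothOneForm_apply G.smooth_V))
  smooth_ell2 := (G.smooth_z.pow 2).mul
    ((D.smooth_ell2.add (contMDiff_const.mul (D.smooth_ell.contMDiff_apply G.smooth_V))).add
      ((D.smooth_γ.isSmoothOneForm_apply G.smooth_V).contMDiff_apply G.smooth_V))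
  symm := D.symm
  signature := D.signature
  nondegenerate p := blockMap_gauge_isInvertible (T := EuclideanSpace ℝ (Fin n))
    (D.γ p) (D.symm p) (D.ell p) (D.ell2 p) (D.nondegenerate p) (G.z p) (G.z_ne_zero p) (G.V p)

end NullMetricData

variable {M : Type*} [TopologicalSpace M] [ChartedSpace (EuclideanSpace ℝ (Fin (n + 1))) M]
  [IsManifold (𝓡 (n + 1)) ∞ M]

/-- The push-forward `φ_*` at `p`. -/
abbrev pushforward (φ : N → M) (p : N) :
    TangentSpace (𝓡 n) p →L[ℝ] TangentSpace (𝓡 (n + 1)) (φ p) :=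
  mfderiv (𝓡 n) (𝓡 (n + 1)) φ p

/-- The null metric hypersurface data `D` is `(φ, ξ)`-embedded in `(M, g)`: `φ` is a smooth
embedding, the rigging `ξ` is a smooth vector field along `φ`, everywhere transverse to `φ(N)`, and
`φ^*g = γ`, `φ^*(g(ξ,·)) = ℓ`, `φ^*(g(ξ,ξ)) = ℓ⁽²⁾`. -/
structure NullMetricData.IsEmbedded (D : NullMetricData n N) (g : LorentzianMetric (n + 1) M)
    (φ : N → M) (ξ : ∀ p : N, TangentSpace (𝓡 (n + 1)) (φ p)) : Prop where
  embedding : Manifold.IsSmoothEmbedding (𝓡 n) (𝓡 (n + 1)) ∞ φ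
  smooth_rigging : ContMDiff (𝓡 n) (𝓡 (n + 1)).tangent ∞
    (fun p ↦ (⟨φ p, ξ p⟩ : TangentBundle (𝓡 (n + 1)) M))
  transverse : ∀ (p : N) (v : TangentSpace (𝓡 n) p), pushforward φ p v ≠ ξ p
  pullback_γ : ∀ (p : N) (v w : TangentSpace (𝓡 n) p),
    g.val (φ p) (pushforward φ p v) (pushforward φ p w) = D.γ p v w
  pullback_ell : ∀ (p : N) (v : TangentSpace (𝓡 n) p),
    g.val (φ p) (ξ p) (pushforward φ p v) = D.ell p v
  pullback_ell2 : ∀ p : N, g.val (φ p) (ξ p) (ξ p) = D.ell2 p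

/-- `η` is a smooth vector field on the open neighbourhood `W` of `φ(N)` that extends the vector
field `X` along `φ`. (Values of `η` outside of `W` are irrelevant.) -/
structure IsExtension (φ : N → M) (X : ∀ p : N, TangentSpace (𝓡 (n + 1)) (φ p)) (W : Set M)
    (η : ∀ x : M, TangentSpace (𝓡 (n + 1)) x) : Prop where
  isOpen : IsOpen W
  range_subset : Set.range φ ⊆ W
  smooth : ContMDiffOn (𝓡 (n + 1)) (𝓡 (n + 1)).tangent ∞
    (fun x ↦ (⟨x, η x⟩ : TangentBundle (𝓡 (n + 1)) M)) W
  eq_on : ∀ p : N, η (φ p) = X p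

/-- The deformation tensor `K[η] = £_η g` at `x`. -/
def LorentzianMetric.deformation (g : LorentzianMetric (n + 1) M)
    (η : ∀ x : M, TangentSpace (𝓡 (n + 1)) x) (x : M) :
    TangentSpace (𝓡 (n + 1)) x →L[ℝ] TangentSpace (𝓡 (n + 1)) x →L[ℝ] ℝ :=
  lieDeriv η g.smooth x

/-- `Ξ` is a smooth vector field near `φ(p)` that extends the vector field `X` along `φ`. -/
def IsLocalExtension (φ : N → M) (X : ∀ p : N, TangentSpace (𝓡 (n + 1)) (φ p)) (p : N)
    (Ξ : ∀ x : M, TangentSpace (𝓡 (n + 1)) x) : Prop :=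
  ∃ W : Set M, IsOpen W ∧ φ p ∈ W ∧
    ContMDiffOn (𝓡 (n + 1)) (𝓡 (n + 1)).tangent ∞
      (fun x ↦ (⟨x, Ξ x⟩ : TangentBundle (𝓡 (n + 1)) M)) W ∧
    ∀ p' : N, φ p' ∈ W → Ξ (φ p') = X p'

/-- `(£_ξ η)(φ(p)) = B` for a vector field `ξ` along `φ`: local extensions `Ξ` of `ξ` exist, and all
of them have `[Ξ, η] = B` at `φ(p)`. -/
def HasLieDerivAlong (φ : N → M) (ξ : ∀ p : N, TangentSpace (𝓡 (n + 1)) (φ p))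
    (η : ∀ x : M, TangentSpace (𝓡 (n + 1)) x) (p : N) (B : TangentSpace (𝓡 (n + 1)) (φ p)) :
    Prop :=
  (∃ Ξ, IsLocalExtension φ ξ p Ξ) ∧
    ∀ Ξ, IsLocalExtension φ ξ p Ξ → mlieBracket (𝓡 (n + 1)) Ξ η (φ p) = B

/-- The gauge transformed rigging `z (ξ + φ_* V)`. -/
def gaugeRigging (φ : N → M) (ξ : ∀ p : N, TangentSpace (𝓡 (n + 1)) (φ p))
    (G : GaugeParam n N) (p : N) : TangentSpace (𝓡 (n + 1)) (φ p) :=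
  G.z p • (ξ p + pushforward φ p (G.V p))

variable (n N) in
/-- A metric `K`-tuple `{N, γ, ℓ, ℓ⁽²⁾, α, 𝔭, 𝔮}`, in a given gauge. The smoothness of `α, 𝔭, 𝔮` is
`MetricKTuple.IsSmooth`, and the gauge transformation laws are `MetricKTuple.gauge`. -/
structure MetricKTuple where
  /-- the null metric hypersurface data -/
  data : NullMetricData n N
  /-- the function `α` -/
  α : N → ℝ
  /-- the function `𝔭` -/
  pfun : N → ℝ
  /-- the covector field `𝔮` -/
  q : ∀ p : N, TangentSpace (𝓡 n) p →L[ℝ] ℝ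

namespace MetricKTuple

variable (T : MetricKTuple n N)

/-- Smoothness of `α, 𝔭, 𝔮`. -/
structure IsSmooth : Prop where
  smooth_α : ContMDiff (𝓡 n) 𝓘(ℝ) ∞ T.α
  smooth_pfun : ContMDiff (𝓡 n) 𝓘(ℝ) ∞ T.pfun
  smooth_q : IsSmoothOneForm (𝓡 n) T.q

/-- The gauge transformation laws: `α ↦ z α`, `𝔮 ↦ z (𝔮 + 2 α U(V,·))`,
`𝔭 ↦ z² (𝔭 + 2 𝔮(V) + 2 α U(V,V))`. -/
def gauge (G : GaugeParam n N) : MetricKTuple n N where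
  data := T.data.gauge G
  α p := G.z p * T.α p
  pfun p := G.z p ^ 2 *
    (T.pfun p + 2 * T.q p (G.V p) + 2 * T.α p * T.data.U p (G.V p) (G.V p))
  q p := G.z p • (T.q p + (2 * T.α p) • T.data.U p (G.V p))

/-- The vector field `η̄ = α n` on `N`. -/
def etaBar (p : N) : TangentSpace (𝓡 n) p := T.α p • T.data.nvec p

/-- The metric `K`-tuple `T` is `(φ, ξ)`-embedded in `(M, g)` by means of the extension `η` of
`φ_* η̄` to the open neighbourhood `W` of `φ(N)`: the deformation tensor `K[η]` satisfies
`φ^*K[η] = 2 α U`, `φ^*(K[η](ξ,·)) = 𝔮`, `φ^*(K[η](ξ,ξ)) = 𝔭`. -/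
structure IsEmbeddedBy (g : LorentzianMetric (n + 1) M)
    (φ : N → M) (ξ : ∀ p : N, TangentSpace (𝓡 (n + 1)) (φ p)) (W : Set M)
    (η : ∀ x : M, TangentSpace (𝓡 (n + 1)) x) : Prop where
  data : T.data.IsEmbedded g φ ξ
  extend : IsExtension φ (fun p ↦ pushforward φ p (T.etaBar p)) W η
  tangent : ∀ (p : N) (v w : TangentSpace (𝓡 n) p),
    g.deformation η (φ p) (pushforward φ p v) (pushforward φ p w) = 2 * T.α p * T.data.U p v w
  mixed : ∀ (p : N) (v : TangentSpace (𝓡 n) p),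
    g.deformation η (φ p) (ξ p) (pushforward φ p v) = T.q p v
  rigging : ∀ p : N, g.deformation η (φ p) (ξ p) (ξ p) = T.pfun p

/-- The metric `K`-tuple `T` is `(φ, ξ)`-embedded in `(M, g)`. -/
def IsEmbedded (g : LorentzianMetric (n + 1) M)
    (φ : N → M) (ξ : ∀ p : N, TangentSpace (𝓡 (n + 1)) (φ p)) : Prop :=
  ∃ W η, T.IsEmbeddedBy g φ ξ W η

/-- The vector
`(𝔮 - dα)(n) ξ + φ_*(½ (𝔭 - α n(ℓ⁽²⁾)) n + P(𝔮 - 2 α s - dα, ·))` at `φ(p)`. -/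
def transverseDeriv (φ : N → M) (ξ : ∀ p : N, TangentSpace (𝓡 (n + 1)) (φ p)) (p : N) :
    TangentSpace (𝓡 (n + 1)) (φ p) :=
  (T.q p - mvfderiv (𝓡 n) T.α p) (T.data.nvec p) • ξ p +
    pushforward φ p
      (((1 / 2 : ℝ) * (T.pfun p - T.α p * mvfderiv (𝓡 n) T.data.ell2 p (T.data.nvec p))) •
          T.data.nvec p +
        T.data.P p (T.q p - (2 * T.α p) • T.data.s p - mvfderiv (𝓡 n) T.α p))

end MetricKTuple

end Data

end

/-!
The two components of `K[η] = £_η g` that involve the rigging are affine in the bracket `[ξ, η]`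
along the hypersurface. For tangent fields this uses that brackets of `φ`-related vector fields are
`φ`-related (`mlieBracket_of_related`): if `V'` extends `φ_* V`, then `[η, V']` restricts to
`φ_*[η̄, V]`, so that `K[η](φ_*V, φ_*W) = (£_η̄ γ)(V, W) = 2 α U(V, W)` for every extension `η`, and
`K[η](ξ, φ_*V) = (£_η̄ ℓ)(V) + g([ξ, η], φ_*V)` with `£_η̄ ℓ = 2 α s + dα`. Likewise
`K[η](ξ, ξ) = η̄(ℓ⁽²⁾) + 2 g([ξ, η], ξ)`. Since `ξ` and the tangent vectors span, prescribing these
components is the same as prescribing `[ξ, η]`, and inverting the block matrix `𝒜` gives the formula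
for it (`MetricKTuple.deformation_iff_mlieBracket`). This proves the characterization of the
embedding extensions; as the deformation tensor at a point does not refer to an extension of `ξ`, it
also shows that `[Ξ, η]` does not depend on the extension `Ξ`, once one of them gives the prescribed
value.

For existence, the prescribed value `B` is a smooth field along `φ`, because its products with `ξ`
and with smooth tangent fields are smooth (`NullMetricData.IsEmbedded.smoothAlongOn_of_pairing`,
Cramer's rule). Near a point, let `η₀` be any extension of `φ_* η̄`, `Ξ` one of `ξ`, and `f` a
function that vanishes on the hypersurface with `df(ξ) ≠ 0`. Then `[Ξ, η₀ + f Z] = [Ξ, η₀] + df(ξ)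
Z` on the hypersurface, so that `Z = df(ξ)⁻¹ (B - [Ξ, η₀])` works
(`MetricKTuple.exists_local_solution`). The local solutions `η_i` are glued with functions `ρ_i`
with sum one near the hypersurface: `[Ξ, ∑ ρ_i η_i] = ∑ ρ_i B + (∑ dρ_i(ξ)) φ_* η̄ = B`, as all
`η_i` restrict to `φ_* η̄`. The hypersurface is not assumed to be closed, so the `ρ_i` are built by
hand from countably many bump functions on a neighbourhood of it (`exists_smooth_partition_near`).
If it is closed, the result is multiplied by a cutoff function that is one near the hypersurface.

The gauge laws hold since `η̄` is gauge invariant, and `𝔮`, `𝔭` transform as the components of the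
fixed symmetric tensor `K[η]` with respect to the rigging.
-/

/-! ### Lie brackets of related vector fields -/

section Related

variable {E : Type*} [NormedAddCommGroup E] [NormedSpace ℝ E] [CompleteSpace E]
  {H : Type*} [TopologicalSpace H] {I : ModelWithCorners ℝ E H} [I.Boundaryless]
  {M : Type*} [TopologicalSpace M] [ChartedSpace H M] [IsManifold I ∞ M]
  {F : Type*} [NormedAddCommGroup F] [NormedSpace ℝ F]

/-- The representative of a vector field in the chart at `x`. -/
noncomputable def chartRep (V : ∀ x : M, TangentSpace I x) (x : M) : E → E :=
  mpullbackWithin 𝓘(ℝ, E) I (extChartAt I x).symm V (Set.range I)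

theorem differentiableAt_chartRep {V : ∀ x : M, TangentSpace I x} {x : M}
    (hV : MDifferentiableAt I I.tangent (fun y ↦ (⟨y, V y⟩ : TangentBundle I M)) x) :
    DifferentiableAt ℝ (chartRep V x) (extChartAt I x x) := by
  have : IsManifold I 2 M := IsManifold.of_le (n := ∞) (by norm_cast)
  have h : DifferentiableWithinAt ℝ (chartRep V x)
      ((extChartAt I x).symm ⁻¹' Set.univ ∩ Set.range I) (extChartAt I x x) :=
    (mdifferentiableWithinAt_univ.2 hV).differentiableWithinAt_mpullbackWithin_vectorField
  rwa [I.range_eq_univ, Set.preimage_univ, Set.univ_inter, differentiableWithinAt_univ] at h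

omit [CompleteSpace E] [I.Boundaryless] in
theorem mfderiv_extChartAt_apply_eq_chartRep (V : ∀ x : M, TangentSpace I x) {x y : M}
    (hy : y ∈ (extChartAt I x).source) :
    mfderiv I 𝓘(ℝ, E) (extChartAt I x) y (V y) = chartRep V x (extChartAt I x y) := by
  have : IsManifold I 1 M := IsManifold.of_le (n := ∞) (by norm_cast)
  have A : (extChartAt I x).symm (extChartAt I x y) = y := (extChartAt I x).left_inv hy
  have h1 := mfderiv_extChartAt_comp_mfderivWithin_extChartAt_symm' (I := I) hy
  have h2 := mfderivWithin_extChartAt_symm_comp_mfderiv_extChartAt' (I := I) hy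
  let S : E →L[ℝ] E :=
    mfderivWithin 𝓘(ℝ, E) I (extChartAt I x).symm (Set.range I) (extChartAt I x y)
  let D : E →L[ℝ] E := mfderiv I 𝓘(ℝ, E) (extChartAt I x) y
  have hinv : S.inverse = D := ContinuousLinearMap.inverse_eq h2 h1
  have hV : (show E from V ((extChartAt I x).symm (extChartAt I x y))) = V y :=
    congrArg (fun z ↦ (show E from V z)) A
  change D (V y) = S.inverse (show E from V ((extChartAt I x).symm (extChartAt I x y)))
  rw [hinv, hV]

omit [CompleteSpace E] in
theorem mvfderiv_eq_chartRep {f : M → F} {x : M} (hf : ContMDiffAt I 𝓘(ℝ, F) 2 f x)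
    (V : ∀ x : M, TangentSpace I x) :
    (fun y ↦ mvfderiv I f y (V y)) =ᶠ[𝓝 x]
      (fun z ↦ fderiv ℝ (f ∘ (extChartAt I x).symm) z (chartRep V x z)) ∘ extChartAt I x := by
  have : IsManifold I 2 M := IsManifold.of_le (n := ∞) (by norm_cast)
  have h2 : ∀ᶠ y in 𝓝 x, ContMDiffAt I 𝓘(ℝ, F) 2 f y :=
    (contMDiffAt_iff_contMDiffAt_nhds (by simp)).1 hf
  filter_upwards [h2, extChartAt_source_mem_nhds (I := I) x] with y hfy hy
  have hy' : y ∈ (chartAt H x).source := by simpa using hy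
  have e : f =ᶠ[𝓝 y] (f ∘ (extChartAt I x).symm) ∘ extChartAt I x := by
    filter_upwards [extChartAt_source_mem_nhds' hy] with w hw
    simp only [Function.comp_apply, (extChartAt I x).left_inv hw]
  have A : (extChartAt I x).symm (extChartAt I x y) = y := (extChartAt I x).left_inv hy
  have hs : MDifferentiableAt 𝓘(ℝ, E) I (extChartAt I x).symm (extChartAt I x y) :=
    ((contMDiffOn_extChartAt_symm (n := 2) x).contMDiffAt
      (extChartAt_target_mem_nhds' ((extChartAt I x).map_source hy))).mdifferentiableAt
        (by norm_num)
  have hg : MDifferentiableAt 𝓘(ℝ, E) 𝓘(ℝ, F) (f ∘ (extChartAt I x).symm)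
      (extChartAt I x y) := by
    refine MDifferentiableAt.comp _ ?_ hs
    rw [A]
    exact hfy.mdifferentiableAt (by norm_num)
  have hc : MDifferentiableAt I 𝓘(ℝ, E) (extChartAt I x) y :=
    (contMDiffAt_extChartAt' (n := 2) hy').mdifferentiableAt (by norm_num)
  have key : mfderiv I 𝓘(ℝ, F) f y =
      (mfderiv 𝓘(ℝ, E) 𝓘(ℝ, F) (f ∘ (extChartAt I x).symm) (extChartAt I x y)).comp
        (mfderiv I 𝓘(ℝ, E) (extChartAt I x) y) := by
    rw [e.mfderiv_eq]
    exact mfderiv_comp _ hg hc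
  simp only [Function.comp_apply]
  rw [← mfderiv_extChartAt_apply_eq_chartRep V hy]
  change mfderiv I 𝓘(ℝ, F) f y (V y) = _
  rw [key, mfderiv_eq_fderiv]
  rfl

omit [CompleteSpace E] [IsManifold I ∞ M] in
theorem contDiffAt_comp_extChartAt_symm {f : M → F} {x : M}
    (hf : ContMDiffAt I 𝓘(ℝ, F) 2 f x) :
    ContDiffAt ℝ 2 (f ∘ (extChartAt I x).symm) (extChartAt I x x) := by
  have := (contMDiffAt_iff.1 hf).2
  rw [I.range_eq_univ, contDiffWithinAt_univ] at this
  exact this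

theorem mdifferentiableAt_mvfderiv_apply {f : M → F} {x : M}
    (hf : ContMDiffAt I 𝓘(ℝ, F) 2 f x) {V : ∀ x : M, TangentSpace I x}
    (hV : MDifferentiableAt I I.tangent (fun y ↦ (⟨y, V y⟩ : TangentBundle I M)) x) :
    MDifferentiableAt I 𝓘(ℝ, F) (fun y ↦ mvfderiv I f y (V y)) x := by
  have : IsManifold I 2 M := IsManifold.of_le (n := ∞) (by norm_cast)
  refine MDifferentiableAt.congr_of_eventuallyEq ?_ (mvfderiv_eq_chartRep hf V)
  have h : DifferentiableAt ℝ (fderiv ℝ (f ∘ (extChartAt I x).symm)) (extChartAt I x x) :=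
    ((contDiffAt_comp_extChartAt_symm hf).fderiv_right (m := 1) (by norm_num)).differentiableAt
      (by norm_num)
  exact MDifferentiableAt.comp x (h.clm_apply (differentiableAt_chartRep hV)).mdifferentiableAt
    (mdifferentiableAt_extChartAt (mem_chart_source H x))

/-- The derivation given by a Lie bracket is the commutator of the derivations. -/
theorem mvfderiv_mlieBracket {f : M → F} {x : M}
    (hf : ContMDiffAt I 𝓘(ℝ, F) 2 f x) {V W : ∀ x : M, TangentSpace I x}
    (hV : MDifferentiableAt I I.tangent (fun y ↦ (⟨y, V y⟩ : TangentBundle I M)) x)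
    (hW : MDifferentiableAt I I.tangent (fun y ↦ (⟨y, W y⟩ : TangentBundle I M)) x) :
    mvfderiv I f x (mlieBracket I V W x) =
      mvfderiv I (fun y ↦ mvfderiv I f y (W y)) x (V x) -
        mvfderiv I (fun y ↦ mvfderiv I f y (V y)) x (W x) := by
  have : IsManifold I 2 M := IsManifold.of_le (n := ∞) (by norm_cast)
  have hd := contDiffAt_comp_extChartAt_symm hf
  have h : DifferentiableAt ℝ (fderiv ℝ (f ∘ (extChartAt I x).symm)) (extChartAt I x x) :=
    (hd.fderiv_right (m := 1) (by norm_num)).differentiableAt (by norm_num)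
  have hx := mem_extChartAt_source (I := I) x
  have D : ∀ V W : ∀ x : M, TangentSpace I x,
      MDifferentiableAt I I.tangent (fun y ↦ (⟨y, W y⟩ : TangentBundle I M)) x →
      mvfderiv I (fun y ↦ mvfderiv I f y (W y)) x (V x) =
      fderiv ℝ (fun z ↦ fderiv ℝ (f ∘ (extChartAt I x).symm) z (chartRep W x z))
        (extChartAt I x x) (chartRep V x (extChartAt I x x)) := by
    intro V W hW
    change mfderiv I 𝓘(ℝ, F) (fun y ↦ mvfderiv I f y (W y)) x (V x) = _
    rw [(mvfderiv_eq_chartRep hf W).mfderiv_eq, mfderiv_comp x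
      (h.clm_apply (differentiableAt_chartRep hW)).mdifferentiableAt
      (mdifferentiableAt_extChartAt (mem_chart_source H x)), mfderiv_eq_fderiv,
      ← mfderiv_extChartAt_apply_eq_chartRep V hx]
    rfl
  rw [D V W hW, D W V hV, ← fderiv_apply_lieBracket hd (by simp) (differentiableAt_chartRep hW)
    (differentiableAt_chartRep hV)]
  have e := (mvfderiv_eq_chartRep hf (mlieBracket I V W)).eq_of_nhds
  refine e.trans ?_
  simp only [Function.comp_apply]
  congr 1
  let D : E →L[ℝ] E := mfderiv I 𝓘(ℝ, E) (extChartAt I x) x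
  have hi : D.IsInvertible := isInvertible_mfderiv_extChartAt hx
  have hb : mlieBracket I V W x = D.inverse (lieBracketWithin ℝ (chartRep V x) (chartRep W x)
      ((extChartAt I x).symm ⁻¹' Set.univ ∩ Set.range I) (extChartAt I x x)) := rfl
  rw [← mfderiv_extChartAt_apply_eq_chartRep _ hx, hb, I.range_eq_univ, Set.preimage_univ,
    Set.univ_inter, lieBracketWithin_univ]
  exact hi.self_apply_inverse _

variable {E' : Type*} [NormedAddCommGroup E'] [NormedSpace ℝ E'] [CompleteSpace E']
  {H' : Type*} [TopologicalSpace H'] {I' : ModelWithCorners ℝ E' H'} [I'.Boundaryless]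
  {M' : Type*} [TopologicalSpace M'] [ChartedSpace H' M'] [IsManifold I' ∞ M']

/-- Lie brackets of vector fields that are related by a map are related by that map. -/
theorem mlieBracket_of_related {φ : M → M'} {x : M} (hφ : ContMDiffAt I I' ∞ φ x)
    {V W : ∀ x : M, TangentSpace I x} {V' W' : ∀ x : M', TangentSpace I' x}
    (hV : MDifferentiableAt I I.tangent (fun y ↦ (⟨y, V y⟩ : TangentBundle I M)) x)
    (hW : MDifferentiableAt I I.tangent (fun y ↦ (⟨y, W y⟩ : TangentBundle I M)) x)
    (hV' : MDifferentiableAt I' I'.tangent (fun y ↦ (⟨y, V' y⟩ : TangentBundle I' M')) (φ x))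
    (hW' : MDifferentiableAt I' I'.tangent (fun y ↦ (⟨y, W' y⟩ : TangentBundle I' M')) (φ x))
    (hVV' : ∀ᶠ y in 𝓝 x, V' (φ y) = mfderiv I I' φ y (V y))
    (hWW' : ∀ᶠ y in 𝓝 x, W' (φ y) = mfderiv I I' φ y (W y)) :
    mlieBracket I' V' W' (φ x) = mfderiv I I' φ x (mlieBracket I V W x) := by
  have : IsManifold I 2 M := IsManifold.of_le (n := ∞) (by norm_cast)
  have : IsManifold I' 2 M' := IsManifold.of_le (n := ∞) (by norm_cast)
  have hφ2 : ContMDiffAt I I' 2 φ x := hφ.of_le (by norm_cast)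
  let f : M' → E' := fun z ↦ extChartAt I' (φ x) z
  have hf2 : ContMDiffAt I' 𝓘(ℝ, E') 2 f (φ x) := contMDiffAt_extChartAt
  have hfφ : ContMDiffAt I 𝓘(ℝ, E') 2 (f ∘ φ) x := hf2.comp x hφ2
  have hev : ∀ᶠ y in 𝓝 x, MDifferentiableAt I I' φ y ∧ MDifferentiableAt I' 𝓘(ℝ, E') f (φ y) := by
    filter_upwards [(contMDiffAt_iff_contMDiffAt_nhds (by simp)).1 hφ2,
      hφ.continuousAt.eventually ((contMDiffAt_iff_contMDiffAt_nhds (by simp)).1 hf2)] with y h1 h2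
    exact ⟨h1.mdifferentiableAt (by norm_num), h2.mdifferentiableAt (by norm_num)⟩
  -- the chain rule for derivatives of `f ∘ φ` along related fields
  have hc : ∀ (W : ∀ x : M, TangentSpace I x) (W' : ∀ x : M', TangentSpace I' x),
      (∀ᶠ y in 𝓝 x, W' (φ y) = mfderiv I I' φ y (W y)) →
      (fun y ↦ mvfderiv I (f ∘ φ) y (W y)) =ᶠ[𝓝 x] (fun y ↦ mvfderiv I' f y (W' y)) ∘ φ := by
    intro W W' h
    filter_upwards [h, hev] with y hy hd
    change mfderiv I 𝓘(ℝ, E') (f ∘ φ) y (W y) = mfderiv I' 𝓘(ℝ, E') f (φ y) (W' (φ y))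
    rw [mfderiv_comp y hd.2 hd.1, hy]
    rfl
  have hc2 : ∀ (V W : ∀ x : M, TangentSpace I x) (V' W' : ∀ x : M', TangentSpace I' x),
      (∀ᶠ y in 𝓝 x, V' (φ y) = mfderiv I I' φ y (V y)) →
      (∀ᶠ y in 𝓝 x, W' (φ y) = mfderiv I I' φ y (W y)) →
      MDifferentiableAt I' I'.tangent (fun y ↦ (⟨y, W' y⟩ : TangentBundle I' M')) (φ x) →
      mvfderiv I' (fun y ↦ mvfderiv I' f y (W' y)) (φ x) (V' (φ x)) =
        mvfderiv I (fun y ↦ mvfderiv I (f ∘ φ) y (W y)) x (V x) := by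
    intro V W V' W' hV hW hd
    change mfderiv I' 𝓘(ℝ, E') (fun y ↦ mvfderiv I' f y (W' y)) (φ x) (V' (φ x)) =
      mfderiv I 𝓘(ℝ, E') (fun y ↦ mvfderiv I (f ∘ φ) y (W y)) x (V x)
    rw [(hc W W' hW).mfderiv_eq, mfderiv_comp x (mdifferentiableAt_mvfderiv_apply hf2 hd)
      hev.self_of_nhds.1, hV.self_of_nhds]
    rfl
  have e1 := mvfderiv_mlieBracket hf2 hV' hW'
  rw [hc2 V W V' W' hVV' hWW' hW', hc2 W V W' V' hWW' hVV' hV',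
    ← mvfderiv_mlieBracket hfφ hV hW] at e1
  have e2 : mvfderiv I (f ∘ φ) x (mlieBracket I V W x) =
      mvfderiv I' f (φ x) (mfderiv I I' φ x (mlieBracket I V W x)) := by
    change mfderiv I 𝓘(ℝ, E') (f ∘ φ) x _ = mfderiv I' 𝓘(ℝ, E') f (φ x) _
    rw [mfderiv_comp x hev.self_of_nhds.2 hev.self_of_nhds.1]
    rfl
  rw [e2] at e1
  exact (isInvertible_mfderiv_extChartAt (I := I')
    (mem_extChartAt_source (I := I') (φ x))).injective e1

end Related

/-! ### Smooth vector fields along maps -/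

section Along

variable {E : Type*} [NormedAddCommGroup E] [NormedSpace ℝ E]
  {H : Type*} [TopologicalSpace H] {I : ModelWithCorners ℝ E H}
  {M : Type*} [TopologicalSpace M] [ChartedSpace H M]
  {E' : Type*} [NormedAddCommGroup E'] [NormedSpace ℝ E']
  {H' : Type*} [TopologicalSpace H'] {I' : ModelWithCorners ℝ E' H'}
  {M' : Type*} [TopologicalSpace M'] [ChartedSpace H' M'] [IsManifold I' ∞ M']
  {E'' : Type*} [NormedAddCommGroup E''] [NormedSpace ℝ E'']
  {H'' : Type*} [TopologicalSpace H''] {I'' : ModelWithCorners ℝ E'' H''}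
  {M'' : Type*} [TopologicalSpace M''] [ChartedSpace H'' M''] [IsManifold I'' ∞ M'']
  {φ : M → M'} {s : Set M}

variable (I I') in
/-- The vector field `X` along the map `φ` is smooth on the set `s`. -/
def SmoothAlongOn (φ : M → M') (X : ∀ x : M, TangentSpace I' (φ x)) (s : Set M) : Prop :=
  ContMDiffOn I I'.tangent ∞ (fun x ↦ (⟨φ x, X x⟩ : TangentBundle I' M')) s

namespace SmoothAlongOn

variable {X Y : ∀ x : M, TangentSpace I' (φ x)} {f : M → ℝ}

theorem contMDiffOn_base (hX : SmoothAlongOn I I' φ X s) : ContMDiffOn I I' ∞ φ s :=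
  (contMDiff_proj (n := ∞) (TangentSpace I' (M := M'))).comp_contMDiffOn hX

theorem mono {t : Set M} (hX : SmoothAlongOn I I' φ X s) (h : t ⊆ s) :
    SmoothAlongOn I I' φ X t := ContMDiffOn.mono hX h

theorem congr (hX : SmoothAlongOn I I' φ X s) (h : ∀ x ∈ s, Y x = X x) :
    SmoothAlongOn I I' φ Y s := ContMDiffOn.congr hX fun x hx ↦ by rw [h x hx]

theorem add (hX : SmoothAlongOn I I' φ X s) (hY : SmoothAlongOn I I' φ Y s) :
    SmoothAlongOn I I' φ (fun x ↦ X x + Y x) s := by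
  intro x hx
  have hX' := contMDiffWithinAt_totalSpace.1 (hX x hx)
  have hY' := contMDiffWithinAt_totalSpace.1 (hY x hx)
  refine contMDiffWithinAt_totalSpace.2 ⟨hX'.1, ?_⟩
  set e := trivializationAt E' (TangentSpace I' (M := M')) (φ x)
  have hmem : ∀ᶠ y in 𝓝[s] x, φ y ∈ e.baseSet :=
    hX'.1.continuousWithinAt.eventually_mem
      (e.open_baseSet.mem_nhds (mem_baseSet_trivializationAt E' _ _))
  refine (hX'.2.add hY'.2).congr_of_eventuallyEq ?_ ?_
  · filter_upwards [hmem] with y hy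
    exact (e.linear ℝ hy).1 _ _
  · exact (e.linear ℝ (mem_baseSet_trivializationAt E' _ _)).1 _ _

theorem smul (hf : ContMDiffOn I 𝓘(ℝ) ∞ f s) (hX : SmoothAlongOn I I' φ X s) :
    SmoothAlongOn I I' φ (fun x ↦ f x • X x) s := by
  intro x hx
  have hX' := contMDiffWithinAt_totalSpace.1 (hX x hx)
  refine contMDiffWithinAt_totalSpace.2 ⟨hX'.1, ?_⟩
  set e := trivializationAt E' (TangentSpace I' (M := M')) (φ x)
  have hmem : ∀ᶠ y in 𝓝[s] x, φ y ∈ e.baseSet :=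
    hX'.1.continuousWithinAt.eventually_mem
      (e.open_baseSet.mem_nhds (mem_baseSet_trivializationAt E' _ _))
  refine ((hf x hx).smul hX'.2).congr_of_eventuallyEq ?_ ?_
  · filter_upwards [hmem] with y hy
    exact (e.linear ℝ hy).2 _ _
  · exact (e.linear ℝ (mem_baseSet_trivializationAt E' _ _)).2 _ _

theorem sub (hX : SmoothAlongOn I I' φ X s) (hY : SmoothAlongOn I I' φ Y s) :
    SmoothAlongOn I I' φ (fun x ↦ X x - Y x) s :=
  (hX.add (smul (f := fun _ ↦ -1) contMDiffOn_const hY)).congr fun x _ ↦ by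
    rw [neg_one_smul, sub_eq_add_neg]

theorem zero (hφ : ContMDiffOn I I' ∞ φ s) : SmoothAlongOn I I' φ (fun _ ↦ 0) s :=
  (contMDiff_zeroSection ℝ (TangentSpace I' (M := M')) (n := ∞) (IB := I')).comp_contMDiffOn hφ

theorem sum (hφ : ContMDiffOn I I' ∞ φ s) {ι : Type*} (t : Finset ι)
    {X : ι → ∀ x : M, TangentSpace I' (φ x)} (hX : ∀ i ∈ t, SmoothAlongOn I I' φ (X i) s) :
    SmoothAlongOn I I' φ (fun x ↦ ∑ i ∈ t, X i x) s := by
  classical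
  induction t using Finset.induction_on with
  | empty => simpa using zero hφ
  | insert i t hi ih =>
    simp only [Finset.sum_insert hi]
    exact (hX i (by simp)).add (ih fun j hj ↦ hX j (by simp [hj]))

/-- The restriction of a smooth vector field to a map. -/
theorem of_vectorField {V : ∀ x : M', TangentSpace I' x} {u : Set M'}
    (hV : ContMDiffOn I' I'.tangent ∞ (fun y ↦ (⟨y, V y⟩ : TangentBundle I' M')) u)
    (hφ : ContMDiffOn I I' ∞ φ s) (h : Set.MapsTo φ s u) :
    SmoothAlongOn I I' φ (fun x ↦ V (φ x)) s :=
  hV.comp hφ h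

theorem comp {N : Type*} {EN : Type*} [NormedAddCommGroup EN] [NormedSpace ℝ EN]
    {HN : Type*} [TopologicalSpace HN] {J : ModelWithCorners ℝ EN HN}
    [TopologicalSpace N] [ChartedSpace HN N] {r : N → M} {t : Set N}
    (hX : SmoothAlongOn I I' φ X s) (hr : ContMDiffOn J I ∞ r t) (h : Set.MapsTo r t s) :
    SmoothAlongOn J I' (φ ∘ r) (fun x ↦ X (r x)) t :=
  ContMDiffOn.comp hX hr h

/-- The push-forward by `f` of a smooth vector field along `φ` is smooth along `f ∘ φ`. -/
theorem mfderiv {f : M' → M''} {u : Set M'} (hu : IsOpen u) (hf : ContMDiffOn I' I'' ∞ f u)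
    (hX : SmoothAlongOn I I' φ X s) (h : Set.MapsTo φ s u) :
    SmoothAlongOn I I'' (fun x ↦ f (φ x)) (fun x ↦ mfderiv I' I'' f (φ x) (X x)) s := by
  have ht : ContMDiffOn I'.tangent I''.tangent ∞ (tangentMapWithin I' I'' f u)
      (Bundle.TotalSpace.proj ⁻¹' u) := hf.contMDiffOn_tangentMapWithin le_rfl hu.uniqueMDiffOn
  refine (ht.comp hX h).congr fun x hx ↦ ?_
  simp only [Function.comp_apply, tangentMapWithin, mfderivWithin_of_isOpen hu (h hx)]

/-- The derivative of a smooth function in the direction of a smooth vector field. -/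
theorem mvfderiv {F : Type*} [NormedAddCommGroup F] [NormedSpace ℝ F] {f : M' → F} {u : Set M'}
    (hu : IsOpen u) (hf : ContMDiffOn I' 𝓘(ℝ, F) ∞ f u)
    (hX : SmoothAlongOn I I' φ X s) (h : Set.MapsTo φ s u) :
    ContMDiffOn I 𝓘(ℝ, F) ∞ (fun x ↦ mvfderiv I' f (φ x) (X x)) s :=
  (contMDiff_snd_tangentBundle_modelSpace F 𝓘(ℝ, F)).comp_contMDiffOn (hX.mfderiv hu hf h)

theorem oneForm_apply {θ : ∀ x : M', TangentSpace I' x →L[ℝ] ℝ} (hθ : IsSmoothOneForm I' θ)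
    (hX : SmoothAlongOn I I' φ X s) :
    ContMDiffOn I 𝓘(ℝ) ∞ (fun x ↦ θ (φ x) (X x)) s := by
  have h : ContMDiffOn I (I'.prod 𝓘(ℝ)) ∞
      (fun m ↦ TotalSpace.mk' ℝ (E := Bundle.Trivial M' ℝ) (φ m) (θ (φ m) (X m))) s := by
    apply ContMDiffOn.clm_bundle_apply (F₁ := E')
    · exact ContMDiff.comp_contMDiffOn hθ hX.contMDiffOn_base
    · exact hX
  intro x hx
  have := h x hx
  simp only [contMDiffWithinAt_totalSpace] at this
  exact this.2

theorem tensor_apply {T : ∀ x : M', TangentSpace I' x →L[ℝ] TangentSpace I' x →L[ℝ] ℝ}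
    (hT : IsSmoothTensor₂ I' T)
    (hX : SmoothAlongOn I I' φ X s) (hY : SmoothAlongOn I I' φ Y s) :
    ContMDiffOn I 𝓘(ℝ) ∞ (fun x ↦ T (φ x) (X x) (Y x)) s := by
  have h : ContMDiffOn I (I'.prod 𝓘(ℝ)) ∞
      (fun m ↦ TotalSpace.mk' ℝ (E := Bundle.Trivial M' ℝ) (φ m) (T (φ m) (X m) (Y m))) s := by
    apply ContMDiffOn.clm_bundle_apply₂ (F₁ := E') (F₂ := E')
    · exact ContMDiff.comp_contMDiffOn hT hX.contMDiffOn_base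
    · exact hX
    · exact hY
  intro x hx
  have := h x hx
  simp only [contMDiffWithinAt_totalSpace] at this
  exact this.2

end SmoothAlongOn

end Along

/-! ### Extending vector fields off an embedded submanifold -/

section Extension

variable {E : Type*} [NormedAddCommGroup E] [NormedSpace ℝ E]
  {H : Type*} [TopologicalSpace H] {I : ModelWithCorners ℝ E H} [I.Boundaryless]
  {N : Type*} [TopologicalSpace N] [ChartedSpace H N] [IsManifold I ∞ N]
  {E' : Type*} [NormedAddCommGroup E'] [NormedSpace ℝ E']
  {H' : Type*} [TopologicalSpace H'] {I' : ModelWithCorners ℝ E' H'}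
  {M : Type*} [TopologicalSpace M] [ChartedSpace H' M] [IsManifold I' ∞ M]
  {φ : N → M}

omit [IsManifold I ∞ N] [IsManifold I' ∞ M] in
/-- An embedded submanifold is, near each of its points, a smooth retract of the ambient
manifold: in adapted charts the retraction is a linear projection. -/
theorem Manifold.IsSmoothEmbedding.exists_local_retraction
    (hφ : Manifold.IsSmoothEmbedding I I' ∞ φ) (p : N) :
    ∃ W : Set M, IsOpen W ∧ φ p ∈ W ∧ ∃ r : M → N, ContMDiffOn I' I ∞ r W ∧
      ∀ q, φ q ∈ W → r (φ q) = q := by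
  have h := hφ.isImmersion.isImmersionAt p
  obtain ⟨O, hO, hOs⟩ := hφ.isEmbedding.isInducing.isOpen_iff.1 h.domChart.open_source
  let pr : E' → E := fun z ↦ (h.equiv.symm z).1
  have hpr : ContDiff ℝ ∞ pr := contDiff_fst.comp h.equiv.symm.contDiff
  have hψ : ContMDiffOn I' 𝓘(ℝ, E') ∞ (h.codChart.extend I') h.codChart.source :=
    OpenPartialHomeomorph.contMDiffOn_extend h.codChart_mem_maximalAtlas
  have hk : ContMDiffOn I' 𝓘(ℝ, E) ∞ (pr ∘ h.codChart.extend I') h.codChart.source :=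
    hpr.contMDiff.comp_contMDiffOn hψ
  have key : ∀ q ∈ h.domChart.source,
      (pr ∘ h.codChart.extend I') (φ q) = h.domChart.extend I q := by
    intro q hq
    have hq' : q ∈ (h.domChart.extend I).source := by rwa [OpenPartialHomeomorph.extend_source]
    have := h.writtenInCharts ((h.domChart.extend I).map_source hq')
    simp only [Function.comp_apply, (h.domChart.extend I).left_inv hq'] at this
    simp only [Function.comp_apply, pr, this, ContinuousLinearEquiv.symm_apply_apply]
  have htgt : IsOpen (h.domChart.extend I).target := h.domChart.isOpen_extend_target
  refine ⟨(h.codChart.source ∩ (pr ∘ h.codChart.extend I') ⁻¹' (h.domChart.extend I).target) ∩ O,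
    (hk.continuousOn.isOpen_inter_preimage h.codChart.open_source htgt).inter hO, ?_,
    (h.domChart.extend I).symm ∘ (pr ∘ h.codChart.extend I'), ?_, ?_⟩
  · have hp := h.mem_domChart_source
    refine ⟨⟨h.mem_codChart_source, ?_⟩, ?_⟩
    · rw [Set.mem_preimage, key p hp]
      exact (h.domChart.extend I).map_source (by rwa [OpenPartialHomeomorph.extend_source])
    · rwa [← hOs] at hp
  · have hs := contMDiffOn_extend_symm (I := I) h.domChart_mem_maximalAtlas
    refine hs.comp (hk.mono fun x hx ↦ hx.1.1) fun x hx ↦ ?_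
    rw [← h.domChart.extend_target']
    exact hx.1.2
  · intro q hq
    have hq' : q ∈ h.domChart.source := by
      rw [← hOs]; exact hq.2
    rw [Function.comp_apply, key q hq']
    exact (h.domChart.extend I).left_inv (by rwa [OpenPartialHomeomorph.extend_source])

omit [IsManifold I ∞ N] in
/-- A smooth vector field along an embedding extends locally to the ambient manifold. -/
theorem SmoothAlongOn.exists_local_extension
    (hφ : Manifold.IsSmoothEmbedding I I' ∞ φ) {X : ∀ q : N, TangentSpace I' (φ q)} {O : Set N}
    (hO : IsOpen O) (hX : SmoothAlongOn I I' φ X O) {p : N} (hp : p ∈ O) :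
    ∃ W : Set M, IsOpen W ∧ φ p ∈ W ∧ (∀ q, φ q ∈ W → q ∈ O) ∧
      ∃ Y : ∀ x : M, TangentSpace I' x,
        ContMDiffOn I' I'.tangent ∞ (fun x ↦ (⟨x, Y x⟩ : TangentBundle I' M)) W ∧
        ∀ q, φ q ∈ W → Y (φ q) = X q := by
  obtain ⟨W, hW, hpW, r, hr, hrφ⟩ := hφ.exists_local_retraction p
  set e := trivializationAt E' (TangentSpace I' (M := M)) (φ p) with he
  have hrp : r (φ p) = p := hrφ p hpW
  -- the open set of points that the retraction moves within the domain of the trivialization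
  have hφc : Continuous φ := hφ.contMDiff.continuous
  have hU : IsOpen (O ∩ φ ⁻¹' e.baseSet) := hO.inter (e.open_baseSet.preimage hφc)
  have hpe : φ p ∈ e.baseSet := mem_baseSet_trivializationAt E' _ _
  refine ⟨(W ∩ r ⁻¹' (O ∩ φ ⁻¹' e.baseSet)) ∩ e.baseSet,
    (hr.continuousOn.isOpen_inter_preimage hW hU).inter e.open_baseSet,
    ⟨⟨hpW, by rw [Set.mem_preimage, hrp]; exact ⟨hp, hpe⟩⟩, hpe⟩,
    fun q hq ↦ ?_, fun x ↦ e.symm x (e ⟨φ (r x), X (r x)⟩).2, ?_, fun q hq ↦ ?_⟩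
  · have := hq.1.2.1
    rwa [hrφ q hq.1.1] at this
  · have h1 : SmoothAlongOn I' I' (φ ∘ r) (fun x ↦ X (r x))
        ((W ∩ r ⁻¹' (O ∩ φ ⁻¹' e.baseSet)) ∩ e.baseSet) :=
      hX.comp (hr.mono fun x hx ↦ hx.1.1) fun x hx ↦ hx.1.2.1
    have h2 := ((e.contMDiffOn_iff (IB := I') (fun x hx ↦ e.mem_source.2 hx.1.2.2)).1 h1).2
    refine (e.contMDiffOn_iff (IB := I') (fun x hx ↦ e.mem_source.2 hx.2)).2
      ⟨contMDiffOn_id, h2.congr fun x hx ↦ ?_⟩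
    rw [e.apply_mk_symm hx.2]
    rfl
  · have hb : φ q ∈ e.baseSet := hq.2
    have hq' : (⟨φ (r (φ q)), X (r (φ q))⟩ : TangentBundle I' M) = ⟨φ q, X q⟩ := by
      rw [hrφ q hq.1.1]
    exact (congrArg (fun y ↦ e.symm (φ q) (e y).2) hq').trans (e.symm_apply_apply_mk hb _)

omit [IsManifold I ∞ N] in
/-- Near a point of an embedded submanifold there is a smooth function that vanishes on the
submanifold and whose derivative in a given transverse direction is nonzero. -/
theorem Manifold.IsSmoothEmbedding.exists_local_defining_function
    (hφ : Manifold.IsSmoothEmbedding I I' ∞ φ) (p : N) {v : TangentSpace I' (φ p)}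
    (hv : ∀ w : TangentSpace I p, mfderiv I I' φ p w ≠ v) :
    ∃ W : Set M, IsOpen W ∧ φ p ∈ W ∧ ∃ f : M → ℝ, ContMDiffOn I' 𝓘(ℝ) ∞ f W ∧
      (∀ q, φ q ∈ W → f (φ q) = 0) ∧ mvfderiv I' f (φ p) v ≠ 0 := by
  obtain ⟨W, hW, hpW, r, hr, hrφ⟩ := hφ.exists_local_retraction p
  set ψ : M → E' := fun x ↦ extChartAt I' (φ p) x with hψdef
  have hψ : ContMDiffOn I' 𝓘(ℝ, E') ∞ ψ (chartAt H' (φ p)).source := contMDiffOn_extChartAt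
  have hφs := hφ.contMDiff
  have hrp : r (φ p) = p := hrφ p hpW
  let S : Set N := φ ⁻¹' (chartAt H' (φ p)).source
  have hS : IsOpen S := (chartAt H' (φ p)).open_source.preimage hφs.continuous
  have hk : ContMDiffOn I 𝓘(ℝ, E') ∞ (ψ ∘ φ) S :=
    hψ.comp hφs.contMDiffOn fun x hx ↦ hx
  have hpS : p ∈ S := mem_chart_source H' (φ p)
  let W' := (W ∩ r ⁻¹' S) ∩ (chartAt H' (φ p)).source
  have hW' : IsOpen W' := (hr.continuousOn.isOpen_inter_preimage hW hS).inter
    (chartAt H' (φ p)).open_source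
  have hpW' : φ p ∈ W' := ⟨⟨hpW, by rw [Set.mem_preimage, hrp]; exact hpS⟩, hpS⟩
  have hkr : ContMDiffOn I' 𝓘(ℝ, E') ∞ ((ψ ∘ φ) ∘ r) W' :=
    hk.comp (hr.mono fun x hx ↦ hx.1.1) fun x hx ↦ hx.1.2
  have hψ' : ContMDiffOn I' 𝓘(ℝ, E') ∞ ψ W' := hψ.mono fun x hx ↦ hx.2
  let dr : E' →L[ℝ] E := mfderiv I' I r (φ p)
  let dφ : E →L[ℝ] E' := mfderiv I I' φ p
  let dψ : E' →L[ℝ] E' := mfderiv I' 𝓘(ℝ, E') ψ (φ p)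
  have hdφ : MDifferentiableAt I I' φ p := hφs.mdifferentiableAt (by simp)
  have hdψ : MDifferentiableAt I' 𝓘(ℝ, E') ψ (φ p) :=
    (hψ'.contMDiffAt (hW'.mem_nhds hpW')).mdifferentiableAt (by simp)
  have hdr : MDifferentiableAt I' I r (φ p) :=
    (hr.contMDiffAt (hW.mem_nhds hpW)).mdifferentiableAt (by simp)
  have hdk : MDifferentiableAt I 𝓘(ℝ, E') (ψ ∘ φ) p := hdψ.comp p hdφ
  have e1 : (show E →L[ℝ] E' from mfderiv I 𝓘(ℝ, E') (ψ ∘ φ) p) = dψ.comp dφ :=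
    mfderiv_comp p hdψ hdφ
  have e2 : (show E' →L[ℝ] E' from mfderiv I' 𝓘(ℝ, E') ((ψ ∘ φ) ∘ r) (φ p)) =
      (show E →L[ℝ] E' from mfderiv I 𝓘(ℝ, E') (ψ ∘ φ) (r (φ p))).comp dr :=
    mfderiv_comp (φ p) (by rwa [hrp]) hdr
  have e3 : (show E →L[ℝ] E' from mfderiv I 𝓘(ℝ, E') (ψ ∘ φ) (r (φ p))) =
      (show E →L[ℝ] E' from mfderiv I 𝓘(ℝ, E') (ψ ∘ φ) p) :=
    congrArg (fun z ↦ (show E →L[ℝ] E' from mfderiv I 𝓘(ℝ, E') (ψ ∘ φ) z)) hrp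
  let v' : E' := v
  have hne : dψ (v' - dφ (dr v)) ≠ 0 := by
    have hi : dψ.IsInvertible := isInvertible_mfderiv_extChartAt (mem_extChartAt_source (φ p))
    intro h0
    have := hi.injective (h0.trans (map_zero dψ).symm)
    exact hv (dr v) (sub_eq_zero.1 this).symm
  obtain ⟨l, hl⟩ := SeparatingDual.exists_ne_zero (R := ℝ) hne
  refine ⟨W', hW', hpW', fun x ↦ l (ψ x - ((ψ ∘ φ) ∘ r) x), ?_, fun q hq ↦ ?_, ?_⟩
  · exact l.contDiff.contMDiff.comp_contMDiffOn (hψ'.sub hkr)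
  · simp [hrφ q hq.1.1]
  · have hdkr : MDifferentiableAt I' 𝓘(ℝ, E') ((ψ ∘ φ) ∘ r) (φ p) :=
      (hkr.contMDiffAt (hW'.mem_nhds hpW')).mdifferentiableAt (by simp)
    have e4 : mvfderiv I' (ψ - (ψ ∘ φ) ∘ r) (φ p) v = dψ (v' - dφ (dr v)) := by
      rw [mvfderiv_sub hdψ hdkr]
      have : mvfderiv I' ((ψ ∘ φ) ∘ r) (φ p) v = dψ (dφ (dr v)) := by
        change (show E' →L[ℝ] E' from mfderiv I' 𝓘(ℝ, E') ((ψ ∘ φ) ∘ r) (φ p)) v = _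
        rw [e2, e3, e1]
        rfl
      rw [sub_apply, this, map_sub]
      rfl
    have e5 : mvfderiv I' (l ∘ (ψ - (ψ ∘ φ) ∘ r)) (φ p) v =
        l (mvfderiv I' (ψ - (ψ ∘ φ) ∘ r) (φ p) v) := by
      change mfderiv I' 𝓘(ℝ) (l ∘ (ψ - (ψ ∘ φ) ∘ r)) (φ p) v = _
      rw [mfderiv_comp (I' := 𝓘(ℝ, E')) (φ p) l.differentiableAt.mdifferentiableAt
        (hdψ.sub hdkr), mfderiv_eq_fderiv, l.fderiv]
      rfl
    change mvfderiv I' (l ∘ (ψ - (ψ ∘ φ) ∘ r)) (φ p) v ≠ 0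
    rw [e5, e4]
    exact hl

end Extension

/-! ### Linear algebra of null metric hypersurface data -/

theorem blockMap_inverse_apply_eq {T : Type*} [AddCommGroup T] [Module ℝ T] [TopologicalSpace T]
    {γ : T →L[ℝ] T →L[ℝ] ℝ} {ell : T →L[ℝ] ℝ} {ell2 : ℝ}
    (h : (blockMap γ ell ell2).IsInvertible) {x : T} {a : ℝ} {θ : T →L[ℝ] ℝ} {c : ℝ}
    (h1 : ∀ v, γ x v + a * ell v = θ v) (h2 : ell x + a * ell2 = c) :
    (blockMap γ ell ell2).inverse (θ, c) = (x, a) := by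
  have e : blockMap γ ell ell2 (x, a) = (θ, c) := by
    refine Prod.ext (ContinuousLinearMap.ext fun v ↦ ?_) ?_
    · simpa [blockMap] using h1 v
    · simpa [blockMap, mul_comm] using h2
  rw [← e]
  exact h.inverse_apply_self _

section Data

variable {n : ℕ} {N : Type*} [TopologicalSpace N]
  [ChartedSpace (EuclideanSpace ℝ (Fin n)) N] [IsManifold (𝓡 n) ∞ N]

namespace NullMetricData

variable (D : NullMetricData n N)

theorem eq_of_pairing_eq (p : N) {x : TangentSpace (𝓡 n) p} {a : ℝ}
    {θ : TangentSpace (𝓡 n) p →L[ℝ] ℝ} {c : ℝ}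
    (h1 : ∀ v, D.γ p x v + a * D.ell p v = θ v) (h2 : D.ell p x + a * D.ell2 p = c) :
    (blockMap (D.γ p) (D.ell p) (D.ell2 p)).inverse (θ, c) = (x, a) :=
  blockMap_inverse_apply_eq (D.nondegenerate p) h1 h2

theorem eq_zero_of_pairing_eq_zero (p : N) {x : TangentSpace (𝓡 n) p} {a : ℝ}
    (h1 : ∀ v, D.γ p x v + a * D.ell p v = 0) (h2 : D.ell p x + a * D.ell2 p = 0) :
    x = 0 ∧ a = 0 := by
  have e := D.eq_of_pairing_eq p (θ := 0) h1 h2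
  rw [Prod.mk_zero_zero, map_zero] at e
  exact ⟨congrArg Prod.fst e.symm, congrArg Prod.snd e.symm⟩

/-- The vector `n` is the null vector of `γ` with `ℓ(n) = 1`: the null vectors of `γ` are not
annihilated by `ℓ`, as the block matrix is non-degenerate. -/
theorem inverse_apply_zero_one [NeZero n] (p : N) :
    ∃ x : TangentSpace (𝓡 n) p, (∀ v, D.γ p x v = 0) ∧ D.ell p x = 1 ∧ D.nvec p = x := by
  obtain ⟨b, hb⟩ := D.signature p
  have hv : ∀ v, D.γ p (b 0) v = 0 := by
    have : (D.γ p (b 0) : TangentSpace (𝓡 n) p →ₗ[ℝ] ℝ) = 0 := b.ext fun j ↦ by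
      by_cases h : 0 = j <;> simp [hb, h]
    exact fun v ↦ LinearMap.congr_fun this v
  have hl : D.ell p (b 0) ≠ 0 := fun h0 ↦
    b.ne_zero 0 (D.eq_zero_of_pairing_eq_zero p (a := 0) (by simp [hv]) (by simp [h0])).1
  refine ⟨(D.ell p (b 0))⁻¹ • b 0, by simp [hv], by simp [hl], ?_⟩
  rw [nvec, D.eq_of_pairing_eq p (x := (D.ell p (b 0))⁻¹ • b 0) (a := 0) (by simp [hv])
    (by simp [hl])]

@[simp]
theorem γ_nvec [NeZero n] (p : N) (v : TangentSpace (𝓡 n) p) : D.γ p (D.nvec p) v = 0 := by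
  obtain ⟨x, hx, -, e⟩ := D.inverse_apply_zero_one p
  rw [e, hx]

@[simp]
theorem γ_nvec_right [NeZero n] (p : N) (v : TangentSpace (𝓡 n) p) :
    D.γ p v (D.nvec p) = 0 := by
  rw [D.symm, γ_nvec]

@[simp]
theorem ell_nvec [NeZero n] (p : N) : D.ell p (D.nvec p) = 1 := by
  obtain ⟨x, -, hx, e⟩ := D.inverse_apply_zero_one p
  rw [e, hx]

/-- The vector field `n` spans the kernel of `γ` and is normalized by `ℓ(n) = 1`. -/
theorem eq_nvec (p : N) {x : TangentSpace (𝓡 n) p}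
    (h : ∀ v, D.γ p x v = 0) (hl : D.ell p x = 1) : D.nvec p = x := by
  rw [nvec, D.eq_of_pairing_eq p (x := x) (a := 0) (by simp [h]) (by simp [hl])]

/-- The inverse of the block matrix has columns `(P, n)` and `(n, 0)`. -/
theorem eq_P_add_smul_nvec [NeZero n] (p : N) {x : TangentSpace (𝓡 n) p} {a : ℝ}
    {θ : TangentSpace (𝓡 n) p →L[ℝ] ℝ} {c : ℝ}
    (h1 : ∀ v, D.γ p x v + a * D.ell p v = θ v) (h2 : D.ell p x + a * D.ell2 p = c) :
    x = c • D.nvec p + D.P p θ ∧ a = θ (D.nvec p) := by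
  constructor
  · have e := D.eq_of_pairing_eq p h1 h2
    have e' : ((θ, c) : (TangentSpace (𝓡 n) p →L[ℝ] ℝ) × ℝ) = c • (0, 1) + (θ, 0) := by
      simp
    rw [e', map_add, map_smul] at e
    exact (congrArg Prod.fst e).symm
  · simpa using h1 (D.nvec p)

end NullMetricData

variable {M : Type*} [TopologicalSpace M] [ChartedSpace (EuclideanSpace ℝ (Fin (n + 1))) M]
  [IsManifold (𝓡 (n + 1)) ∞ M] {g : LorentzianMetric (n + 1) M}
  {φ : N → M} {ξ : ∀ p : N, TangentSpace (𝓡 (n + 1)) (φ p)}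

namespace NullMetricData.IsEmbedded

variable {D : NullMetricData n N} (h : D.IsEmbedded g φ ξ)
include h

theorem contMDiff : ContMDiff (𝓡 n) (𝓡 (n + 1)) ∞ φ := h.embedding.contMDiff

theorem mdifferentiableAt (p : N) : MDifferentiableAt (𝓡 n) (𝓡 (n + 1)) φ p :=
  h.contMDiff.mdifferentiableAt (by simp)

theorem val_add_smul_pushforward (p : N) (x v : TangentSpace (𝓡 n) p) (a : ℝ) :
    g.val (φ p) (pushforward φ p x + a • ξ p) (pushforward φ p v) =
      D.γ p x v + a * D.ell p v := by
  rw [map_add, map_smul, add_apply, smul_apply, h.pullback_γ, h.pullback_ell, smul_eq_mul]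

theorem val_add_smul_rigging (p : N) (x : TangentSpace (𝓡 n) p) (a : ℝ) :
    g.val (φ p) (pushforward φ p x + a • ξ p) (ξ p) = D.ell p x + a * D.ell2 p := by
  rw [map_add, map_smul, add_apply, smul_apply, g.symm, h.pullback_ell, h.pullback_ell2,
    smul_eq_mul]

/-- The rigging complements the tangent spaces of the hypersurface. -/
theorem exists_eq_pushforward_add_smul (p : N) (X : TangentSpace (𝓡 (n + 1)) (φ p)) :
    ∃ (x : TangentSpace (𝓡 n) p) (a : ℝ), X = pushforward φ p x + a • ξ p := by
  let E := EuclideanSpace ℝ (Fin n)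
  let E' := EuclideanSpace ℝ (Fin (n + 1))
  let A : E →L[ℝ] E' := pushforward φ p
  let B : ℝ →ₗ[ℝ] E' := LinearMap.toSpanSingleton ℝ E' (ξ p)
  let L : (E × ℝ) →ₗ[ℝ] E' := A.toLinearMap.coprod B
  have hL : ∀ x a, L (x, a) = pushforward φ p x + a • ξ p := fun x a ↦ rfl
  have hinj : Function.Injective L := by
    rw [← LinearMap.ker_eq_bot, LinearMap.ker_eq_bot']
    rintro ⟨x, a⟩ hx
    rw [hL] at hx
    have h1 : ∀ v, D.γ p x v + a * D.ell p v = 0 := fun v ↦ by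
      rw [← h.val_add_smul_pushforward p x v a, hx]
      exact congrArg (fun f : TangentSpace (𝓡 (n + 1)) (φ p) →L[ℝ] ℝ ↦ f _) (map_zero _)
    have h2 : D.ell p x + a * D.ell2 p = 0 := by
      rw [← h.val_add_smul_rigging p x a, hx]
      exact congrArg (fun f : TangentSpace (𝓡 (n + 1)) (φ p) →L[ℝ] ℝ ↦ f _) (map_zero _)
    obtain ⟨hx0, ha0⟩ := D.eq_zero_of_pairing_eq_zero p h1 h2
    exact Prod.ext hx0 ha0
  have hdim : Module.finrank ℝ (E × ℝ) = Module.finrank ℝ E' := by simp [E, E']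
  obtain ⟨⟨x, a⟩, hxa⟩ := (LinearMap.injective_iff_surjective_of_finrank_eq_finrank hdim).1 hinj X
  exact ⟨x, a, hxa.symm⟩

/-- A vector at a point of the hypersurface is determined by its products with the tangent vectors
and with the rigging. -/
theorem eq_iff_pairing [NeZero n] (p : N) (X : TangentSpace (𝓡 (n + 1)) (φ p))
    (θ : TangentSpace (𝓡 n) p →L[ℝ] ℝ) (c : ℝ) :
    X = θ (D.nvec p) • ξ p + pushforward φ p (c • D.nvec p + D.P p θ) ↔
      (∀ v, g.val (φ p) X (pushforward φ p v) = θ v) ∧ g.val (φ p) X (ξ p) = c := by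
  constructor
  · have hb : blockMap (D.γ p) (D.ell p) (D.ell2 p)
        ((blockMap (D.γ p) (D.ell p) (D.ell2 p)).inverse (θ, c)) = (θ, c) :=
      (D.nondegenerate p).self_apply_inverse _
    rcases hxa : (blockMap (D.γ p) (D.ell p) (D.ell2 p)).inverse (θ, c) with ⟨x, a⟩
    rw [hxa] at hb
    have h1 : ∀ v, D.γ p x v + a * D.ell p v = θ v := fun v ↦ by
      simpa [blockMap] using congrArg (fun f : TangentSpace (𝓡 n) p →L[ℝ] ℝ ↦ f v)
        (congrArg Prod.fst hb)
    have h2 : D.ell p x + a * D.ell2 p = c := by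
      simpa [blockMap, mul_comm] using congrArg Prod.snd hb
    obtain ⟨ex, ea⟩ := D.eq_P_add_smul_nvec p h1 h2
    rw [← ex, ← ea, add_comm (a • ξ p)]
    rintro rfl
    exact ⟨fun v ↦ (h.val_add_smul_pushforward p x v a).trans (h1 v),
      (h.val_add_smul_rigging p x a).trans h2⟩
  · rintro ⟨h1, h2⟩
    obtain ⟨x, a, rfl⟩ := h.exists_eq_pushforward_add_smul p X
    obtain ⟨ex, ea⟩ := D.eq_P_add_smul_nvec p (x := x) (a := a) (θ := θ) (c := c)
      (fun v ↦ by rw [← h.val_add_smul_pushforward]; exact h1 v)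
      (by rw [← h.val_add_smul_rigging]; exact h2)
    rw [← ex, ← ea, add_comm (a • ξ p)]

end NullMetricData.IsEmbedded

end Data

/-! ### Smoothness from metric pairings -/

section LinearSystem

variable {E : Type*} [NormedAddCommGroup E] [NormedSpace ℝ E]
  {H : Type*} [TopologicalSpace H] {I : ModelWithCorners ℝ E H}
  {M : Type*} [TopologicalSpace M] [ChartedSpace H M] {s : Set M}
  {ι : Type*} [Fintype ι] [DecidableEq ι]

theorem contMDiffOn_det {A : M → Matrix ι ι ℝ}
    (hA : ∀ i j, ContMDiffOn I 𝓘(ℝ) ∞ (fun x ↦ A x i j) s) :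
    ContMDiffOn I 𝓘(ℝ) ∞ (fun x ↦ (A x).det) s := by
  simp only [Matrix.det_apply']
  exact contMDiffOn_finsetSum fun σ _ ↦
    contMDiffOn_const.mul (contMDiffOn_finsetProd fun i _ ↦ hA (σ i) i)

/-- The solution of a linear system whose coefficients are smooth is smooth, by Cramer's rule. -/
theorem contMDiffOn_of_mulVec_eq {A : M → Matrix ι ι ℝ} {b c : M → ι → ℝ}
    (hA : ∀ i j, ContMDiffOn I 𝓘(ℝ) ∞ (fun x ↦ A x i j) s)
    (hb : ∀ i, ContMDiffOn I 𝓘(ℝ) ∞ (fun x ↦ b x i) s)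
    (hinj : ∀ x ∈ s, Function.Injective (A x).mulVec)
    (hc : ∀ x ∈ s, (A x).mulVec (c x) = b x) (i : ι) :
    ContMDiffOn I 𝓘(ℝ) ∞ (fun x ↦ c x i) s := by
  have hdet : ∀ x ∈ s, (A x).det ≠ 0 := fun x hx ↦
    ((Matrix.isUnit_iff_isUnit_det _).1 (Matrix.mulVec_injective_iff_isUnit.1 (hinj x hx))).ne_zero
  have hcr : ContMDiffOn I 𝓘(ℝ) ∞ (fun x ↦ ((A x).updateCol i (b x)).det) s := by
    refine contMDiffOn_det fun j k ↦ ?_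
    by_cases hk : k = i
    · subst hk
      simpa [Matrix.updateCol_apply] using hb j
    · simpa [Matrix.updateCol_apply, hk] using hA j k
  have hinv : ContMDiffOn I 𝓘(ℝ) ∞ (fun x ↦ ((A x).det)⁻¹) s := fun x hx ↦
    ((contDiffAt_inv ℝ (hdet x hx)).contMDiffAt (n := ∞)).comp_contMDiffWithinAt x
      (contMDiffOn_det hA x hx)
  refine (hinv.mul hcr).congr fun x hx ↦ ?_
  have h1 : (A x).det • c x = (A x).cramer (b x) := by
    rw [← hc x hx, Matrix.cramer_eq_adjugate_mulVec, Matrix.mulVec_mulVec, Matrix.adjugate_mul,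
      Matrix.smul_mulVec, Matrix.one_mulVec]
  have h2 := congrFun h1 i
  rw [Matrix.cramer_apply, Pi.smul_apply, smul_eq_mul] at h2
  rw [Pi.mul_apply, ← h2, inv_mul_cancel_left₀ (hdet x hx)]

end LinearSystem

section Data

variable {n : ℕ} {N : Type*} [TopologicalSpace N]
  [ChartedSpace (EuclideanSpace ℝ (Fin n)) N] [IsManifold (𝓡 n) ∞ N]
  {M : Type*} [TopologicalSpace M] [ChartedSpace (EuclideanSpace ℝ (Fin (n + 1))) M]
  [IsManifold (𝓡 (n + 1)) ∞ M] {g : LorentzianMetric (n + 1) M}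
  {φ : N → M} {ξ : ∀ p : N, TangentSpace (𝓡 (n + 1)) (φ p)}

namespace NullMetricData.IsEmbedded

variable {D : NullMetricData n N} (h : D.IsEmbedded g φ ξ)
include h

theorem smoothAlongOn_rigging (s : Set N) : SmoothAlongOn (𝓡 n) (𝓡 (n + 1)) φ ξ s :=
  h.smooth_rigging.contMDiffOn

theorem smoothAlongOn_pushforward {V : ∀ p : N, TangentSpace (𝓡 n) p} {s : Set N}
    (hV : ContMDiffOn (𝓡 n) (𝓡 n).tangent ∞ (fun p ↦ (⟨p, V p⟩ : TangentBundle (𝓡 n) N)) s) :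
    SmoothAlongOn (𝓡 n) (𝓡 (n + 1)) φ (fun p ↦ pushforward φ p (V p)) s :=
  SmoothAlongOn.mfderiv (φ := id) isOpen_univ h.contMDiff.contMDiffOn hV (Set.mapsTo_univ _ _)

/-- A vector field along the hypersurface is smooth if its products with smooth tangent fields and
with the rigging are smooth: its components solve the linear system given by the Gram matrix. -/
theorem smoothAlongOn_of_pairing {X : ∀ p : N, TangentSpace (𝓡 (n + 1)) (φ p)}
    (hX : ∀ (O : Set N) (V : ∀ p : N, TangentSpace (𝓡 n) p), IsOpen O →
      ContMDiffOn (𝓡 n) (𝓡 n).tangent ∞ (fun p ↦ (⟨p, V p⟩ : TangentBundle (𝓡 n) N)) O →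
      ContMDiffOn (𝓡 n) 𝓘(ℝ) ∞ (fun p ↦ g.val (φ p) (X p) (pushforward φ p (V p))) O)
    (hXξ : ContMDiff (𝓡 n) 𝓘(ℝ) ∞ (fun p ↦ g.val (φ p) (X p) (ξ p))) :
    SmoothAlongOn (𝓡 n) (𝓡 (n + 1)) φ X Set.univ := by
  intro p₀ _
  rw [contMDiffWithinAt_univ]
  let e := trivializationAt (EuclideanSpace ℝ (Fin n)) (TangentSpace (𝓡 n) (M := N)) p₀
  let s := e.baseSet
  let b := (EuclideanSpace.basisFun (Fin n) ℝ).toBasis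
  let V : Fin n → ∀ p : N, TangentSpace (𝓡 n) p := e.localFrame b
  have hV : ∀ i, ContMDiffOn (𝓡 n) (𝓡 n).tangent ∞
      (fun p ↦ (⟨p, V i p⟩ : TangentBundle (𝓡 n) N)) s :=
    e.contMDiffOn_localFrame_baseSet ∞ b
  let Y : Option (Fin n) → ∀ p : N, TangentSpace (𝓡 (n + 1)) (φ p) := fun k p ↦
    k.elim (ξ p) fun i ↦ pushforward φ p (V i p)
  have hY : ∀ k, SmoothAlongOn (𝓡 n) (𝓡 (n + 1)) φ (Y k) s
    | none => h.smoothAlongOn_rigging s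
    | some i => h.smoothAlongOn_pushforward (hV i)
  -- `Y` is a frame along the hypersurface
  have hsum : ∀ (p : N) (c : Option (Fin n) → ℝ), ∑ k, c k • Y k p =
      pushforward φ p (∑ i, c (some i) • V i p) + c none • ξ p := fun p c ↦ by
    rw [Fintype.sum_option, add_comm (c none • Y none p), map_sum]
    simp only [map_smul]
    rfl
  have hspan : ∀ p ∈ s, ∀ X : TangentSpace (𝓡 (n + 1)) (φ p),
      ∃ c : Option (Fin n) → ℝ, X = ∑ k, c k • Y k p := by
    intro p hp X
    obtain ⟨x, a, rfl⟩ := h.exists_eq_pushforward_add_smul p X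
    refine ⟨fun k ↦ k.elim a fun i ↦ (e.basisAt b hp).repr x i, ?_⟩
    rw [hsum]
    congr 2
    conv_lhs => rw [← (e.basisAt b hp).sum_repr x]
    exact Finset.sum_congr rfl fun i _ ↦ by
      simp only [Option.elim_some, V, e.localFrame_apply_of_mem_baseSet b hp]
  have hindep : ∀ p ∈ s, ∀ c : Option (Fin n) → ℝ,
      (∀ j, g.val (φ p) (∑ k, c k • Y k p) (Y j p) = 0) → c = 0 := by
    intro p hp c hc
    rw [hsum] at hc
    have h2 := hc none
    rw [show Y none p = ξ p from rfl, h.val_add_smul_rigging] at h2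
    have h1 : ∀ v, D.γ p (∑ i, c (some i) • V i p) v + c none * D.ell p v = 0 := by
      have : (D.γ p (∑ i, c (some i) • V i p) + c none • D.ell p :
          TangentSpace (𝓡 n) p →ₗ[ℝ] ℝ) = 0 := (e.basisAt b hp).ext fun j ↦ by
        have := hc (some j)
        rw [show Y (some j) p = pushforward φ p (V j p) from rfl,
          h.val_add_smul_pushforward] at this
        simp only [V, e.localFrame_apply_of_mem_baseSet b hp] at this
        simpa [V, e.localFrame_apply_of_mem_baseSet b hp] using this
      exact fun v ↦ LinearMap.congr_fun this v
    obtain ⟨hx, ha⟩ := D.eq_zero_of_pairing_eq_zero p h1 h2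
    have hli := Fintype.linearIndependent_iff.1 (e.basisAt b hp).linearIndependent
      (fun i ↦ c (some i)) (by
        rw [← hx]
        exact Finset.sum_congr rfl fun i _ ↦ by
          simp only [V, e.localFrame_apply_of_mem_baseSet b hp])
    funext k
    cases k with
    | none => exact ha
    | some i => exact hli i
  -- the components of `X` solve the linear system given by the Gram matrix
  let A : N → Matrix (Option (Fin n)) (Option (Fin n)) ℝ := fun p ↦
    Matrix.of fun j k ↦ g.val (φ p) (Y k p) (Y j p)
  have hA : ∀ p c j, (A p).mulVec c j = g.val (φ p) (∑ k, c k • Y k p) (Y j p) := by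
    intro p c j
    rw [map_sum, sum_apply]
    simp only [A, Matrix.mulVec, dotProduct, Matrix.of_apply, map_smul,
      smul_apply, smul_eq_mul, mul_comm]
  classical
  let c : N → Option (Fin n) → ℝ := fun p ↦ if hp : p ∈ s then (hspan p hp (X p)).choose else 0
  have hcX : ∀ p ∈ s, X p = ∑ k, c p k • Y k p := fun p hp ↦ by
    simp only [c, dif_pos hp]
    exact (hspan p hp (X p)).choose_spec
  have hcs : ∀ k, ContMDiffOn (𝓡 n) 𝓘(ℝ) ∞ (fun p ↦ c p k) s := by
    refine contMDiffOn_of_mulVec_eq (A := A) (b := fun p j ↦ g.val (φ p) (X p) (Y j p))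
      (fun j k ↦ (hY k).tensor_apply g.smooth (hY j)) ?_ ?_ ?_
    · rintro (_ | j)
      · exact hXξ.contMDiffOn
      · exact hX s (V j) e.open_baseSet (hV j)
    · intro p hp
      refine (injective_iff_map_eq_zero (A p).mulVecLin).2 fun c hc ↦ hindep p hp c fun j ↦ ?_
      rw [← hA]
      exact congrFun hc j
    · intro p hp
      funext j
      rw [hA, ← hcX p hp]
  have hsm : SmoothAlongOn (𝓡 n) (𝓡 (n + 1)) φ X s :=
    (SmoothAlongOn.sum h.contMDiff.contMDiffOn Finset.univ fun k _ ↦ (hY k).smul (hcs k)).congr hcX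
  exact ContMDiffOn.contMDiffAt hsm
    (e.open_baseSet.mem_nhds (mem_baseSet_trivializationAt _ _ _))

/-- A vector field on the hypersurface is smooth if its push-forward is smooth. -/
theorem isSmoothVectorField_of_pushforward {V : ∀ p : N, TangentSpace (𝓡 n) p}
    (hV : SmoothAlongOn (𝓡 n) (𝓡 (n + 1)) φ (fun p ↦ pushforward φ p (V p)) Set.univ) :
    IsSmoothVectorField (𝓡 n) V := by
  intro p
  obtain ⟨W, hW, hpW, r, hr, hrφ⟩ := h.embedding.exists_local_retraction p
  have hO : IsOpen (φ ⁻¹' W) := hW.preimage h.contMDiff.continuous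
  have h1 := SmoothAlongOn.mfderiv hW hr (hV.mono (Set.subset_univ (φ ⁻¹' W))) fun q hq ↦ hq
  have h2 : ContMDiffOn (𝓡 n) (𝓡 n).tangent ∞
      (fun p ↦ (⟨p, V p⟩ : TangentBundle (𝓡 n) N)) (φ ⁻¹' W) := by
    refine ContMDiffOn.congr h1 fun q hq ↦ ?_
    have hev : r ∘ φ =ᶠ[𝓝 q] id := by
      filter_upwards [hO.mem_nhds hq] with q' hq' using hrφ q' hq'
    have hd : MDifferentiableAt (𝓡 (n + 1)) (𝓡 n) r (φ q) :=
      (hr.contMDiffAt (hW.mem_nhds hq)).mdifferentiableAt (by simp)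
    let E := EuclideanSpace ℝ (Fin n)
    have e1 : (show E →L[ℝ] E from mfderiv (𝓡 n) (𝓡 n) (r ∘ φ) q) =
        ContinuousLinearMap.id ℝ E := hev.mfderiv_eq.trans mfderiv_id
    have e2 : (show E →L[ℝ] E from mfderiv (𝓡 n) (𝓡 n) (r ∘ φ) q) (V q) =
        (show E from mfderiv (𝓡 (n + 1)) (𝓡 n) r (φ q) (pushforward φ q (V q))) := by
      rw [mfderiv_comp q hd (h.mdifferentiableAt q)]
      rfl
    rw [e1] at e2
    exact congrArg₂ (fun (a : N) (v : E) ↦ (⟨a, v⟩ : TangentBundle (𝓡 n) N)) (hrφ q hq).symm e2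
  exact h2.contMDiffAt (hO.mem_nhds hpW)

theorem isSmoothVectorField_nvec [NeZero n] : IsSmoothVectorField (𝓡 n) D.nvec := by
  refine h.isSmoothVectorField_of_pushforward (h.smoothAlongOn_of_pairing ?_ ?_)
  · intro O V _ _
    refine (contMDiffOn_const (c := 0)).congr fun p _ ↦ ?_
    rw [h.pullback_γ, D.γ_nvec]
  · refine (contMDiff_const (c := 1)).congr fun p ↦ ?_
    rw [g.symm, h.pullback_ell, D.ell_nvec]

end NullMetricData.IsEmbedded

end Data

/-! ### The deformation tensor along the hypersurface -/

section Calculus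

variable {E : Type*} [NormedAddCommGroup E] [NormedSpace ℝ E] [FiniteDimensional ℝ E]
  {H : Type*} [TopologicalSpace H] {I : ModelWithCorners ℝ E H}
  {M : Type*} [TopologicalSpace M] [ChartedSpace H M] [IsManifold I ∞ M]

omit [FiniteDimensional ℝ E] in
theorem mdifferentiableAt_extend {x : M} (v : TangentSpace I x) :
    MDifferentiableAt I I.tangent
      (fun y ↦ (⟨y, FiberBundle.extend E v y⟩ : TangentBundle I M)) x :=
  (contMDiffAt_extend (k := ∞) I E v).mdifferentiableAt (by simp)

/-- `£_{fX} T = f £_X T + df ⊗ T(X,·) + T(·,X) ⊗ df`, with the factors in the appropriate slots. -/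
theorem lieDeriv_smul {T : ∀ x : M, TangentSpace I x →L[ℝ] TangentSpace I x →L[ℝ] ℝ}
    (hT : IsSmoothTensor₂ I T) {f : M → ℝ} {X : ∀ x : M, TangentSpace I x} {x : M}
    (hf : MDifferentiableAt I 𝓘(ℝ) f x)
    (hX : MDifferentiableAt I I.tangent (fun y ↦ (⟨y, X y⟩ : TangentBundle I M)) x)
    (v w : TangentSpace I x) :
    lieDeriv (fun y ↦ f y • X y) hT x v w = f x * lieDeriv X hT x v w +
      mvfderiv I f x v * T x (X x) w + mvfderiv I f x w * T x v (X x) := by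
  have : CompleteSpace E := FiniteDimensional.complete ℝ E
  have hV := mdifferentiableAt_extend (I := I) v
  have hW := mdifferentiableAt_extend (I := I) w
  have hv : FiberBundle.extend E v x = v := FiberBundle.extend_apply_self E v
  have hw : FiberBundle.extend E w x = w := FiberBundle.extend_apply_self E w
  have e1 := lieDeriv_apply (fun y ↦ f y • X y) hT hV hW
  have e2 := lieDeriv_apply X hT hV hW
  rw [show (fun y ↦ f y • X y) = f • X from rfl, mlieBracket_smul_left hf hX,
    mlieBracket_smul_left hf hX] at e1
  rw [hv, hw] at e1 e2
  rw [show (fun y ↦ f y • X y) = f • X from rfl, e1, e2]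
  simp
  ring

theorem extDerivForm_self {θ : ∀ x : M, TangentSpace I x →L[ℝ] ℝ} (hθ : IsSmoothOneForm I θ)
    {x : M} (v : TangentSpace I x) : extDerivForm hθ x v v = 0 := by
  have hv : FiberBundle.extend E v x = v := FiberBundle.extend_apply_self E v
  have e := extDerivForm_apply hθ (mdifferentiableAt_extend (I := I) v)
    (mdifferentiableAt_extend (I := I) v)
  rw [hv] at e
  simpa using e

end Calculus

section Data

variable {n : ℕ} {N : Type*} [TopologicalSpace N]
  [ChartedSpace (EuclideanSpace ℝ (Fin n)) N] [IsManifold (𝓡 n) ∞ N]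
  {M : Type*} [TopologicalSpace M] [ChartedSpace (EuclideanSpace ℝ (Fin (n + 1))) M]
  [IsManifold (𝓡 (n + 1)) ∞ M] {g : LorentzianMetric (n + 1) M}
  {φ : N → M} {ξ : ∀ p : N, TangentSpace (𝓡 (n + 1)) (φ p)}

theorem NullMetricData.s_nvec (D : NullMetricData n N) (p : N) : D.s p (D.nvec p) = 0 := by
  simp [s, F, extDerivForm_self]

theorem IsSmoothVectorField.mdifferentiableAt {X : ∀ p : N, TangentSpace (𝓡 n) p}
    (hX : IsSmoothVectorField (𝓡 n) X) (p : N) :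
    MDifferentiableAt (𝓡 n) (𝓡 n).tangent (fun q ↦ (⟨q, X q⟩ : TangentBundle (𝓡 n) N)) p :=
  (hX p).mdifferentiableAt (by simp)

omit [IsManifold (𝓡 n) ∞ N] [IsManifold (𝓡 (n + 1)) ∞ M] in
/-- The chain rule for functions that agree along the hypersurface. -/
theorem mvfderiv_pushforward {F : M → ℝ} {f : N → ℝ} {p : N}
    (hφ : MDifferentiableAt (𝓡 n) (𝓡 (n + 1)) φ p)
    (hF : MDifferentiableAt (𝓡 (n + 1)) 𝓘(ℝ) F (φ p)) (h : ∀ᶠ q in 𝓝 p, F (φ q) = f q)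
    (v : TangentSpace (𝓡 n) p) :
    mvfderiv (𝓡 (n + 1)) F (φ p) (pushforward φ p v) = mvfderiv (𝓡 n) f p v := by
  have h' : f =ᶠ[𝓝 p] F ∘ φ := h.mono fun q hq ↦ hq.symm
  have e : mvfderiv (𝓡 n) f p v = mvfderiv (𝓡 n) (F ∘ φ) p v := by
    change mfderiv (𝓡 n) 𝓘(ℝ) f p v = mfderiv (𝓡 n) 𝓘(ℝ) (F ∘ φ) p v
    rw [h'.mfderiv_eq]
    rfl
  rw [e]
  exact (mvfderiv_comp_apply p hF hφ v).symm

/-- Every tangent vector of an embedded submanifold extends to a vector field on the submanifold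
that is related to a vector field of the ambient manifold. -/
theorem Manifold.IsSmoothEmbedding.exists_related
    (hφ : Manifold.IsSmoothEmbedding (𝓡 n) (𝓡 (n + 1)) ∞ φ) (p : N) (v : TangentSpace (𝓡 n) p) :
    ∃ (V : ∀ p : N, TangentSpace (𝓡 n) p) (V' : ∀ x : M, TangentSpace (𝓡 (n + 1)) x),
      MDifferentiableAt (𝓡 n) (𝓡 n).tangent (fun q ↦ (⟨q, V q⟩ : TangentBundle (𝓡 n) N)) p ∧
      MDifferentiableAt (𝓡 (n + 1)) (𝓡 (n + 1)).tangent
        (fun x ↦ (⟨x, V' x⟩ : TangentBundle (𝓡 (n + 1)) M)) (φ p) ∧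
      V p = v ∧ ∀ᶠ q in 𝓝 p, V' (φ q) = pushforward φ q (V q) := by
  obtain ⟨s, hs, hV⟩ := exists_contMDiffOn_extend (k := ∞) (𝓡 n) (EuclideanSpace ℝ (Fin n)) v
  obtain ⟨O, hOs, hO, hpO⟩ := mem_nhds_iff.1 hs
  have hX : SmoothAlongOn (𝓡 n) (𝓡 (n + 1)) φ (fun q ↦ pushforward φ q
      (FiberBundle.extend (EuclideanSpace ℝ (Fin n)) v q)) O :=
    SmoothAlongOn.mfderiv (φ := id) isOpen_univ hφ.contMDiff.contMDiffOn (hV.mono hOs)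
      (Set.mapsTo_univ _ _)
  obtain ⟨W, hW, hpW, -, V', hV', hV'φ⟩ := hX.exists_local_extension hφ hO hpO
  refine ⟨_, V', mdifferentiableAt_extend v,
    (hV'.contMDiffAt (hW.mem_nhds hpW)).mdifferentiableAt (by simp),
    FiberBundle.extend_apply_self _ v, ?_⟩
  filter_upwards [(hW.preimage hφ.contMDiff.continuous).mem_nhds hpW] with q hq using hV'φ q hq

namespace MetricKTuple

variable {T : MetricKTuple n N}

theorem isSmoothVectorField_etaBar [NeZero n] (hT : T.IsSmooth) (h : T.data.IsEmbedded g φ ξ) :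
    IsSmoothVectorField (𝓡 n) T.etaBar :=
  ContMDiff.smul_section hT.smooth_α h.isSmoothVectorField_nvec

/-- `£_{αn} ℓ = 2 α s + dα`. -/
theorem lieDeriv_ell [NeZero n] (hT : T.IsSmooth) (h : T.data.IsEmbedded g φ ξ) {p : N}
    {V : ∀ p : N, TangentSpace (𝓡 n) p}
    (hV : MDifferentiableAt (𝓡 n) (𝓡 n).tangent (fun q ↦ (⟨q, V q⟩ : TangentBundle (𝓡 n) N)) p) :
    mvfderiv (𝓡 n) (fun q ↦ T.data.ell q (V q)) p (T.etaBar p) -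
        T.data.ell p (mlieBracket (𝓡 n) T.etaBar V p) =
      2 * T.α p * T.data.s p (V p) + mvfderiv (𝓡 n) T.α p (V p) := by
  have e := extDerivForm_apply T.data.smooth_ell
    ((T.isSmoothVectorField_etaBar hT h).mdifferentiableAt p) hV
  have hα : (fun q ↦ T.data.ell q (T.etaBar q)) = T.α := by
    funext q; simp [etaBar]
  rw [hα] at e
  have e2 : extDerivForm T.data.smooth_ell p (T.etaBar p) (V p) =
      2 * T.α p * T.data.s p (V p) := by
    simp [etaBar, NullMetricData.s, NullMetricData.F]
    ring
  rw [e2] at e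
  linarith

/-- `£_{αn} γ = 2 α U`, because `γ(n,·) = 0`. -/
theorem lieDeriv_γ [NeZero n] (hT : T.IsSmooth) (h : T.data.IsEmbedded g φ ξ) (p : N)
    (v w : TangentSpace (𝓡 n) p) :
    lieDeriv T.etaBar T.data.smooth_γ p v w = 2 * T.α p * T.data.U p v w := by
  have e := lieDeriv_smul T.data.smooth_γ (hT.smooth_α.mdifferentiableAt (by simp) (x := p))
    (h.isSmoothVectorField_nvec.mdifferentiableAt p) v w
  rw [T.data.γ_nvec, T.data.γ_nvec_right] at e
  refine e.trans ?_
  simp [NullMetricData.U]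
  ring

omit [IsManifold (𝓡 (n + 1)) ∞ M] in
/-- The vector `transverseDeriv` in terms of the covector `𝔮 - 2 α s - dα` alone, because
`s(n) = 0`. -/
theorem transverseDeriv_eq (p : N) : T.transverseDeriv φ ξ p =
    (T.q p - (2 * T.α p) • T.data.s p - mvfderiv (𝓡 n) T.α p) (T.data.nvec p) • ξ p +
      pushforward φ p
        (((1 / 2 : ℝ) * (T.pfun p - T.α p * mvfderiv (𝓡 n) T.data.ell2 p (T.data.nvec p))) •
          T.data.nvec p +
        T.data.P p (T.q p - (2 * T.α p) • T.data.s p - mvfderiv (𝓡 n) T.α p)) := by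
  simp [transverseDeriv, T.data.s_nvec]

section Deformation

variable [NeZero n] (hT : T.IsSmooth) (h : T.data.IsEmbedded g φ ξ) {p : N}
  {η : ∀ x : M, TangentSpace (𝓡 (n + 1)) x}
  (hη : MDifferentiableAt (𝓡 (n + 1)) (𝓡 (n + 1)).tangent
    (fun x ↦ (⟨x, η x⟩ : TangentBundle (𝓡 (n + 1)) M)) (φ p))
  (hηφ : ∀ᶠ q in 𝓝 p, η (φ q) = pushforward φ q (T.etaBar q))
include hT h hη hηφ

/-- The tangential components of the deformation tensor do not depend on the extension. -/
theorem deformation_tangent (v w : TangentSpace (𝓡 n) p) :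
    g.deformation η (φ p) (pushforward φ p v) (pushforward φ p w) =
      2 * T.α p * T.data.U p v w := by
  obtain ⟨V, V', hV, hV', rfl, hVV'⟩ := h.embedding.exists_related p v
  obtain ⟨W, W', hW, hW', rfl, hWW'⟩ := h.embedding.exists_related p w
  have hbar := (T.isSmoothVectorField_etaBar hT h).mdifferentiableAt p
  rw [← lieDeriv_γ hT h p, ← hVV'.self_of_nhds, ← hWW'.self_of_nhds, LorentzianMetric.deformation,
    lieDeriv_apply η g.smooth hV' hW', lieDeriv_apply T.etaBar T.data.smooth_γ hV hW,
    mlieBracket_of_related h.contMDiff.contMDiffAt hbar hV hη hV' hηφ hVV',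
    mlieBracket_of_related h.contMDiff.contMDiffAt hbar hW hη hW' hηφ hWW',
    hηφ.self_of_nhds, hVV'.self_of_nhds, hWW'.self_of_nhds, h.pullback_γ, h.pullback_γ,
    mvfderiv_pushforward (h.mdifferentiableAt p) (g.smooth.mdifferentiableAt_apply hV' hW')
      (f := fun q ↦ T.data.γ q (V q) (W q))]
  filter_upwards [hVV', hWW'] with q hq hq'
  rw [hq, hq', h.pullback_γ]

variable {Ξ : ∀ x : M, TangentSpace (𝓡 (n + 1)) x}
  (hΞ : MDifferentiableAt (𝓡 (n + 1)) (𝓡 (n + 1)).tangent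
    (fun x ↦ (⟨x, Ξ x⟩ : TangentBundle (𝓡 (n + 1)) M)) (φ p))
  (hΞφ : ∀ᶠ q in 𝓝 p, Ξ (φ q) = ξ q)
include hΞ hΞφ

theorem deformation_mixed (v : TangentSpace (𝓡 n) p) :
    g.deformation η (φ p) (ξ p) (pushforward φ p v) =
      2 * T.α p * T.data.s p v + mvfderiv (𝓡 n) T.α p v +
        g.val (φ p) (mlieBracket (𝓡 (n + 1)) Ξ η (φ p)) (pushforward φ p v) := by
  obtain ⟨V, V', hV, hV', rfl, hVV'⟩ := h.embedding.exists_related p v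
  have hbar := (T.isSmoothVectorField_etaBar hT h).mdifferentiableAt p
  rw [← lieDeriv_ell hT h hV, ← hVV'.self_of_nhds, ← hΞφ.self_of_nhds,
    LorentzianMetric.deformation, lieDeriv_apply η g.smooth hΞ hV',
    mlieBracket_of_related h.contMDiff.contMDiffAt hbar hV hη hV' hηφ hVV',
    hηφ.self_of_nhds, hΞφ.self_of_nhds, h.pullback_ell,
    mvfderiv_pushforward (h.mdifferentiableAt p) (g.smooth.mdifferentiableAt_apply hΞ hV')
      (f := fun q ↦ T.data.ell q (V q)), mlieBracket_swap_apply (V := η)]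
  · rw [map_neg, neg_apply]
    ring
  · filter_upwards [hVV', hΞφ] with q hq hq'
    rw [hq, hq', h.pullback_ell]

omit [NeZero n] hT hη in
theorem deformation_rigging :
    g.deformation η (φ p) (ξ p) (ξ p) =
      T.α p * mvfderiv (𝓡 n) T.data.ell2 p (T.data.nvec p) +
        2 * g.val (φ p) (mlieBracket (𝓡 (n + 1)) Ξ η (φ p)) (ξ p) := by
  rw [← hΞφ.self_of_nhds, LorentzianMetric.deformation, lieDeriv_apply η g.smooth hΞ hΞ,
    hηφ.self_of_nhds,
    mvfderiv_pushforward (h.mdifferentiableAt p) (g.smooth.mdifferentiableAt_apply hΞ hΞ)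
      (f := T.data.ell2), mlieBracket_swap_apply (V := η), g.symm (φ p) (Ξ (φ p))]
  · rw [map_neg, neg_apply, etaBar, map_smul, smul_eq_mul]
    ring
  · filter_upwards [hΞφ] with q hq'
    rw [hq', h.pullback_ell2]

/-- At a point of the hypersurface, the mixed and rigging components of the deformation tensor
are the prescribed ones if and only if the transverse derivative is. -/
theorem deformation_iff_mlieBracket :
    ((∀ v : TangentSpace (𝓡 n) p,
        g.deformation η (φ p) (ξ p) (pushforward φ p v) = T.q p v) ∧
      g.deformation η (φ p) (ξ p) (ξ p) = T.pfun p) ↔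
    mlieBracket (𝓡 (n + 1)) Ξ η (φ p) = T.transverseDeriv φ ξ p := by
  rw [transverseDeriv_eq, h.eq_iff_pairing p]
  simp only [deformation_mixed hT h hη hηφ hΞ hΞφ, deformation_rigging h hηφ hΞ hΞφ]
  refine and_congr (forall_congr' fun v ↦ ?_) ?_
  · simp only [sub_apply, smul_apply, smul_eq_mul]
    constructor <;> intro h <;> linarith
  · constructor <;> intro h <;> linarith

end Deformation

end MetricKTuple

end Data

/-! ### Local existence of the extension -/

section Bracket

variable {E : Type*} [NormedAddCommGroup E] [NormedSpace ℝ E] [CompleteSpace E]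
  {H : Type*} [TopologicalSpace H] {I : ModelWithCorners ℝ E H}
  {M : Type*} [TopologicalSpace M] [ChartedSpace H M] [IsManifold I ∞ M]

theorem ContMDiffAt.mlieBracket_infty {V W : ∀ x : M, TangentSpace I x} {x : M}
    (hV : ContMDiffAt I I.tangent ∞ (fun y ↦ (⟨y, V y⟩ : TangentBundle I M)) x)
    (hW : ContMDiffAt I I.tangent ∞ (fun y ↦ (⟨y, W y⟩ : TangentBundle I M)) x) :
    ContMDiffAt I I.tangent ∞ (fun y ↦ (⟨y, mlieBracket I V W y⟩ : TangentBundle I M)) x := by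
  have : IsManifold I (((⊤ : ℕ∞) : ℕ∞ω) + 1) M := by
    rw [show ((⊤ : ℕ∞) : ℕ∞ω) + 1 = ∞ from rfl]
    infer_instance
  have : IsManifold I (minSmoothness ℝ 2) M := by
    rw [minSmoothness_of_isRCLikeNormedField]
    infer_instance
  exact ContMDiffAt.mlieBracket_vectorField (n := ⊤) (m := ⊤) hV hW
    (by rw [minSmoothness_of_isRCLikeNormedField]; rfl)

end Bracket

section Data

variable {n : ℕ} {N : Type*} [TopologicalSpace N]
  [ChartedSpace (EuclideanSpace ℝ (Fin n)) N] [IsManifold (𝓡 n) ∞ N]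
  {M : Type*} [TopologicalSpace M] [ChartedSpace (EuclideanSpace ℝ (Fin (n + 1))) M]
  [IsManifold (𝓡 (n + 1)) ∞ M] {g : LorentzianMetric (n + 1) M}
  {φ : N → M} {ξ : ∀ p : N, TangentSpace (𝓡 (n + 1)) (φ p)}

omit [TopologicalSpace N] [ChartedSpace (EuclideanSpace ℝ (Fin n)) N] [IsManifold (𝓡 n) ∞ N] in
theorem IsLocalExtension.mdifferentiableAt {p : N} {Ξ : ∀ x : M, TangentSpace (𝓡 (n + 1)) x}
    (hΞ : IsLocalExtension φ ξ p Ξ) : MDifferentiableAt (𝓡 (n + 1)) (𝓡 (n + 1)).tangent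
      (fun x ↦ (⟨x, Ξ x⟩ : TangentBundle (𝓡 (n + 1)) M)) (φ p) := by
  obtain ⟨W, hW, hpW, hs, -⟩ := hΞ
  exact (hs.contMDiffAt (hW.mem_nhds hpW)).mdifferentiableAt (by simp)

omit [ChartedSpace (EuclideanSpace ℝ (Fin n)) N] [IsManifold (𝓡 n) ∞ N] in
theorem IsLocalExtension.eventually_eq {p : N} {Ξ : ∀ x : M, TangentSpace (𝓡 (n + 1)) x}
    (hΞ : IsLocalExtension φ ξ p Ξ) (hφ : ContinuousAt φ p) : ∀ᶠ q in 𝓝 p, Ξ (φ q) = ξ q := by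
  obtain ⟨W, hW, hpW, -, h⟩ := hΞ
  filter_upwards [hφ (hW.mem_nhds hpW)] with q hq using h q hq

theorem NullMetricData.IsEmbedded.exists_isLocalExtension {D : NullMetricData n N}
    (h : D.IsEmbedded g φ ξ) (p : N) : ∃ Ξ, IsLocalExtension φ ξ p Ξ := by
  obtain ⟨W, hW, hpW, -, Ξ, hΞ, hΞφ⟩ :=
    (h.smoothAlongOn_rigging Set.univ).exists_local_extension h.embedding isOpen_univ
      (Set.mem_univ p)
  exact ⟨Ξ, W, hW, hpW, hΞ, hΞφ⟩

namespace MetricKTuple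

variable {T : MetricKTuple n N} [NeZero n]

theorem val_transverseDeriv (h : T.data.IsEmbedded g φ ξ) (p : N) :
    (∀ v, g.val (φ p) (T.transverseDeriv φ ξ p) (pushforward φ p v) =
        T.q p v - (2 * T.α p * T.data.s p v + mvfderiv (𝓡 n) T.α p v)) ∧
      g.val (φ p) (T.transverseDeriv φ ξ p) (ξ p) =
        1 / 2 * (T.pfun p - T.α p * mvfderiv (𝓡 n) T.data.ell2 p (T.data.nvec p)) := by
  obtain ⟨h1, h2⟩ := (h.eq_iff_pairing p _ _ _).1 (T.transverseDeriv_eq (φ := φ) (ξ := ξ) p)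
  refine ⟨fun v ↦ ?_, h2⟩
  rw [h1]
  simp only [sub_apply, smul_apply, smul_eq_mul]
  ring

theorem smoothAlongOn_transverseDeriv (hT : T.IsSmooth) (h : T.data.IsEmbedded g φ ξ) :
    SmoothAlongOn (𝓡 n) (𝓡 (n + 1)) φ (T.transverseDeriv φ ξ) Set.univ := by
  refine h.smoothAlongOn_of_pairing ?_ ?_
  · intro O V hO hV
    have hV' : SmoothAlongOn (𝓡 n) (𝓡 n) id V O := hV
    have hbar := T.isSmoothVectorField_etaBar hT h
    have hbar' : SmoothAlongOn (𝓡 n) (𝓡 n) id T.etaBar O := hbar.contMDiffOn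
    have hbr : SmoothAlongOn (𝓡 n) (𝓡 n) id (fun p ↦ mlieBracket (𝓡 n) T.etaBar V p) O :=
      fun p hp ↦ ((hbar p).mlieBracket_infty
        (hV.contMDiffAt (hO.mem_nhds hp))).contMDiffWithinAt
    have h1 := hV'.oneForm_apply T.data.smooth_ell
    have h2 := hbar'.mvfderiv hO h1 fun p hp ↦ hp
    refine ((hV'.oneForm_apply hT.smooth_q).sub
      (h2.sub (hbr.oneForm_apply T.data.smooth_ell))).congr fun p hp ↦ ?_
    rw [(T.val_transverseDeriv h p).1, ← lieDeriv_ell hT h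
      ((hV.contMDiffAt (hO.mem_nhds hp)).mdifferentiableAt (by simp))]
    rfl
  · have h1 : ContMDiff (𝓡 n) 𝓘(ℝ) ∞ (fun p ↦ mvfderiv (𝓡 n) T.data.ell2 p (T.data.nvec p)) := by
      rw [← contMDiffOn_univ]
      exact SmoothAlongOn.mvfderiv (φ := id) (X := T.data.nvec) isOpen_univ
        T.data.smooth_ell2.contMDiffOn h.isSmoothVectorField_nvec.contMDiffOn fun _ hp ↦ hp
    exact (contMDiff_const.mul (hT.smooth_pfun.sub (hT.smooth_α.mul h1))).congr fun p ↦
      (T.val_transverseDeriv h p).2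

/-- The Lie bracket with the extension of `φ_* η̄` does not depend on the extension of `ξ`: by
`deformation_iff_mlieBracket`, prescribing it is a condition on the deformation tensor. -/
theorem mlieBracket_eq_transverseDeriv (hT : T.IsSmooth) (h : T.data.IsEmbedded g φ ξ) {p : N}
    {η Ξ Ξ' : ∀ x : M, TangentSpace (𝓡 (n + 1)) x}
    (hη : MDifferentiableAt (𝓡 (n + 1)) (𝓡 (n + 1)).tangent
      (fun x ↦ (⟨x, η x⟩ : TangentBundle (𝓡 (n + 1)) M)) (φ p))
    (hηφ : ∀ᶠ q in 𝓝 p, η (φ q) = pushforward φ q (T.etaBar q))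
    (hΞ : IsLocalExtension φ ξ p Ξ) (hΞ' : IsLocalExtension φ ξ p Ξ')
    (hB : mlieBracket (𝓡 (n + 1)) Ξ η (φ p) = T.transverseDeriv φ ξ p) :
    mlieBracket (𝓡 (n + 1)) Ξ' η (φ p) = T.transverseDeriv φ ξ p := by
  have hc := h.contMDiff.continuous.continuousAt (x := p)
  rw [← deformation_iff_mlieBracket hT h hη hηφ hΞ.mdifferentiableAt (hΞ.eventually_eq hc)] at hB
  rwa [← deformation_iff_mlieBracket hT h hη hηφ hΞ'.mdifferentiableAt (hΞ'.eventually_eq hc)]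

/-- Local existence: correcting an arbitrary extension `η₀` by `f Z`, where `f` vanishes on the
hypersurface and `df(ξ) ≠ 0`, changes `[ξ, η₀]` by `df(ξ) Z`, so that a suitable `Z` gives the
prescribed transverse derivative. -/
theorem exists_local_solution (hT : T.IsSmooth) (h : T.data.IsEmbedded g φ ξ) (p : N) :
    ∃ W : Set M, IsOpen W ∧ φ p ∈ W ∧ ∃ η : ∀ x : M, TangentSpace (𝓡 (n + 1)) x,
      ContMDiffOn (𝓡 (n + 1)) (𝓡 (n + 1)).tangent ∞
        (fun x ↦ (⟨x, η x⟩ : TangentBundle (𝓡 (n + 1)) M)) W ∧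
      (∀ q, φ q ∈ W → η (φ q) = pushforward φ q (T.etaBar q)) ∧
      ∀ q, φ q ∈ W → ∀ Ξ, IsLocalExtension φ ξ q Ξ →
        mlieBracket (𝓡 (n + 1)) Ξ η (φ q) = T.transverseDeriv φ ξ q := by
  have hφ := h.embedding
  have hφc : Continuous φ := h.contMDiff.continuous
  obtain ⟨Ξ, W₁, hW₁, hpW₁, hΞ, hΞφ⟩ := h.exists_isLocalExtension p
  obtain ⟨W₂, hW₂, hpW₂, -, η₀, hη₀, hη₀φ⟩ := (h.smoothAlongOn_pushforward (s := Set.univ)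
    (T.isSmoothVectorField_etaBar hT h).contMDiffOn).exists_local_extension hφ isOpen_univ
    (Set.mem_univ p)
  obtain ⟨W₃, hW₃, hpW₃, f, hf, hfφ, hdf⟩ := hφ.exists_local_defining_function p (h.transverse p)
  -- the open set on which the linear equation for `Z` can be solved
  let O₁ : Set N := φ ⁻¹' ((W₁ ∩ W₂) ∩ W₃)
  have hO₁ : IsOpen O₁ := ((hW₁.inter hW₂).inter hW₃).preimage hφc
  let a : N → ℝ := fun q ↦ mvfderiv (𝓡 (n + 1)) f (φ q) (ξ q)
  have ha : ContMDiffOn (𝓡 n) 𝓘(ℝ) ∞ a O₁ :=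
    (h.smoothAlongOn_rigging O₁).mvfderiv hW₃ hf fun q hq ↦ hq.2
  let O : Set N := O₁ ∩ a ⁻¹' {0}ᶜ
  have hO : IsOpen O := ha.continuousOn.isOpen_inter_preimage hO₁ isOpen_compl_singleton
  have hinv : ContMDiffOn (𝓡 n) 𝓘(ℝ) ∞ (fun q ↦ (a q)⁻¹) O := fun q hq ↦
    ((contDiffAt_inv ℝ hq.2).contMDiffAt (n := ∞)).comp_contMDiffWithinAt q
      (ha.mono Set.inter_subset_left q hq)
  have hbr : SmoothAlongOn (𝓡 n) (𝓡 (n + 1)) φ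
      (fun q ↦ mlieBracket (𝓡 (n + 1)) Ξ η₀ (φ q)) O := by
    refine SmoothAlongOn.of_vectorField (u := W₁ ∩ W₂) (fun x hx ↦ ?_) h.contMDiff.contMDiffOn
      fun q hq ↦ hq.1.1
    exact ((hΞ.contMDiffAt (hW₁.mem_nhds hx.1)).mlieBracket_infty
      (hη₀.contMDiffAt (hW₂.mem_nhds hx.2))).contMDiffWithinAt
  have hZ := (((smoothAlongOn_transverseDeriv hT h).mono (Set.subset_univ O)).sub hbr).smul hinv
  obtain ⟨W₄, hW₄, hpW₄, hW₄O, Z, hZ, hZφ⟩ := hZ.exists_local_extension hφ hO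
    (p := p) ⟨⟨⟨hpW₁, hpW₂⟩, hpW₃⟩, hdf⟩
  refine ⟨(W₂ ∩ W₃) ∩ W₄, (hW₂.inter hW₃).inter hW₄, ⟨⟨hpW₂, hpW₃⟩, hpW₄⟩, η₀ + f • Z, ?_⟩
  have hval : ∀ q, φ q ∈ (W₂ ∩ W₃) ∩ W₄ →
      (η₀ + f • Z) (φ q) = pushforward φ q (T.etaBar q) := fun q hq ↦ by
    simp [hfφ q hq.1.2, hη₀φ q hq.1.1]
  have hsm : ContMDiffOn (𝓡 (n + 1)) (𝓡 (n + 1)).tangent ∞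
      (fun x ↦ (⟨x, (η₀ + f • Z) x⟩ : TangentBundle (𝓡 (n + 1)) M)) ((W₂ ∩ W₃) ∩ W₄) :=
    ContMDiffOn.add_section (hη₀.mono fun x hx ↦ hx.1.1)
      (ContMDiffOn.smul_section (hf.mono fun x hx ↦ hx.1.2) (hZ.mono fun x hx ↦ hx.2))
  refine ⟨hsm, hval, fun q hq Ξ' hΞ' ↦ ?_⟩
  have hqO := hW₄O q hq.2
  have hopen : IsOpen ((W₂ ∩ W₃) ∩ W₄) := (hW₂.inter hW₃).inter hW₄
  have hloc : IsLocalExtension φ ξ q Ξ := ⟨W₁, hW₁, hqO.1.1.1, hΞ, hΞφ⟩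
  refine mlieBracket_eq_transverseDeriv hT h
    ((hsm.contMDiffAt (hopen.mem_nhds hq)).mdifferentiableAt (by simp)) ?_ hloc hΞ' ?_
  · filter_upwards [(hopen.preimage hφc).mem_nhds hq] with q' hq' using hval q' hq'
  · have hdf' := (hf.contMDiffAt (hW₃.mem_nhds hq.1.2)).mdifferentiableAt (by simp)
    have hdZ := (hZ.contMDiffAt (hW₄.mem_nhds hq.2)).mdifferentiableAt (by simp)
    have hdη := (hη₀.contMDiffAt (hW₂.mem_nhds hq.1.1)).mdifferentiableAt (by simp)
    have hdfZ := (ContMDiffAt.smul_section (hf.contMDiffAt (hW₃.mem_nhds hq.1.2))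
      (hZ.contMDiffAt (hW₄.mem_nhds hq.2))).mdifferentiableAt (by simp)
    rw [mlieBracket_add_right hdη hdfZ, mlieBracket_smul_right hdf' hdZ, hfφ q hq.1.2,
      hΞφ q hqO.1.1.1, hZφ q hq.2, zero_smul, add_zero]
    change _ + a q • ((a q)⁻¹ • _) = _
    rw [smul_inv_smul₀ hqO.2]
    abel

end MetricKTuple

end Data

/-! ### Gluing -/

section Gluing

variable {E : Type*} [NormedAddCommGroup E] [NormedSpace ℝ E] [FiniteDimensional ℝ E]
  {H : Type*} [TopologicalSpace H] {I : ModelWithCorners ℝ E H}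
  {M : Type*} [TopologicalSpace M] [ChartedSpace H M] [IsManifold I ∞ M]

/-- Smooth functions that form a partition of unity near a nonempty subset `S` of a manifold,
subordinate to a given family of neighbourhoods of the points of `S`. The subset need not be closed:
the sums are only locally finite, and equal to one, on an open neighbourhood of `S`. The functions
are the products `ψ i * ∏ j < i, (1 - ψ j)` for countably many bump functions `ψ i` such that the
sets `{ψ i = 1}` cover `S`. -/
theorem exists_smooth_partition_near [T2Space M] [SecondCountableTopology M] {S : Set M}
    (hS : S.Nonempty) {U : M → Set M} (hU : ∀ x ∈ S, U x ∈ 𝓝 x) :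
    ∃ (W : Set M) (c : ℕ → M) (ρ : ℕ → M → ℝ), IsOpen W ∧ S ⊆ W ∧ (∀ i, c i ∈ S) ∧
      (∀ i, ContMDiff I 𝓘(ℝ) ∞ (ρ i)) ∧ (∀ i, tsupport (ρ i) ⊆ U (c i)) ∧
      ∀ x ∈ W, ∃ m, ∀ᶠ y in 𝓝 x, (∀ k, m ≤ k → ρ k y = 0) ∧
        ∑ i ∈ Finset.range m, ρ i y = 1 := by
  have h0 : ∀ x, ∃ ψ : SmoothBumpFunction I x, x ∈ S → tsupport ψ ⊆ U x := fun x ↦ by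
    by_cases hx : x ∈ S
    · obtain ⟨ψ, -, hψ⟩ := (SmoothBumpFunction.nhds_basis_tsupport (I := I) x).mem_iff.1 (hU x hx)
      exact ⟨ψ, fun _ ↦ hψ⟩
    · exact ⟨Classical.arbitrary _, fun h ↦ absurd h hx⟩
  choose ψ hψ using h0
  obtain ⟨t, htS, htc, ht⟩ := TopologicalSpace.countable_cover_nhdsWithin
    (f := fun x ↦ interior {y | ψ x y = 1}) (s := S) fun x _ ↦
      mem_nhdsWithin_of_mem_nhds (interior_mem_nhds.2 (ψ x).eventuallyEq_one)
  have htne : t.Nonempty := by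
    obtain ⟨x, hx⟩ := hS
    obtain ⟨y, hy, -⟩ := Set.mem_iUnion₂.1 (ht hx)
    exact ⟨y, hy⟩
  obtain ⟨c, rfl⟩ := htc.exists_eq_range htne
  let ρ : ℕ → M → ℝ := fun i y ↦ ψ (c i) y * ∏ j ∈ Finset.range i, (1 - ψ (c j) y)
  have hsum : ∀ m y, ∑ i ∈ Finset.range m, ρ i y =
      1 - ∏ j ∈ Finset.range m, (1 - ψ (c j) y) := fun m y ↦ by
    induction m with
    | zero => simp
    | succ m ih =>
      rw [Finset.sum_range_succ, Finset.prod_range_succ, ih]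
      ring
  refine ⟨⋃ i, interior {y | ψ (c i) y = 1}, c, ρ, isOpen_iUnion fun _ ↦ isOpen_interior, ?_,
    fun i ↦ htS ⟨i, rfl⟩, fun i ↦ ?_, fun i ↦ ?_, fun x hx ↦ ?_⟩
  · simpa using ht
  · exact (ψ (c i)).contMDiff.mul
      (contMDiff_finsetProd fun j _ ↦ contMDiff_const.sub (ψ (c j)).contMDiff)
  · exact (closure_mono (Function.support_mul_subset_left _ _)).trans (hψ (c i) (htS ⟨i, rfl⟩))
  · obtain ⟨i, hi⟩ := Set.mem_iUnion.1 hx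
    refine ⟨i + 1, ?_⟩
    filter_upwards [mem_interior_iff_mem_nhds.1 hi] with y hy
    have hprod : ∀ k, i + 1 ≤ k → ∏ j ∈ Finset.range k, (1 - ψ (c j) y) = 0 := fun k hk ↦
      Finset.prod_eq_zero (Finset.mem_range.2 hk) (sub_eq_zero.2 (Eq.symm hy))
    exact ⟨fun k hk ↦ by simp [ρ, hprod k hk], by rw [hsum, hprod _ le_rfl, sub_zero]⟩

omit [FiniteDimensional ℝ E] [IsManifold I ∞ M] in
theorem mlieBracket_apply_eq_zero_of_eventuallyEq {X Y : ∀ x : M, TangentSpace I x} {x : M}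
    (h : ∀ᶠ y in 𝓝 x, Y y = 0) : mlieBracket I X Y x = 0 := by
  have h' : Y =ᶠ[𝓝 x] 0 := h
  exact (Filter.EventuallyEq.rfl.mlieBracket_vectorField_eq h').trans
    (congrFun (mlieBracket_zero_right (I := I) (W := X)) x)

omit [FiniteDimensional ℝ E] [IsManifold I ∞ M] in
theorem mvfderiv_apply_eq_zero_of_eventuallyEq_const {f : M → ℝ} {c : ℝ} {x : M}
    (h : ∀ᶠ y in 𝓝 x, f y = c) (v : TangentSpace I x) : mvfderiv I f x v = 0 := by
  have h' : f =ᶠ[𝓝 x] fun _ ↦ c := h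
  change mfderiv I 𝓘(ℝ) f x v = _
  rw [h'.mfderiv_eq]
  exact congrArg (fun L : TangentSpace I x →L[ℝ] ℝ ↦ L v) (mfderiv_const (c := c))

omit [FiniteDimensional ℝ E] [IsManifold I ∞ M] in
theorem mvfderiv_sum_apply {ι : Type*} (t : Finset ι) {f : ι → M → ℝ} {x : M}
    (hf : ∀ i, ContMDiff I 𝓘(ℝ) ∞ (f i)) (v : TangentSpace I x) :
    mvfderiv I (fun y ↦ ∑ i ∈ t, f i y) x v = ∑ i ∈ t, mvfderiv I (f i) x v := by
  classical
  induction t using Finset.induction_on with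
  | empty => simpa using mvfderiv_apply_eq_zero_of_eventuallyEq_const (c := 0) (by simp) v
  | insert i t hi ih =>
    simp only [Finset.sum_insert hi]
    rw [← ih, mvfderiv_fun_add ((hf i).mdifferentiableAt (by simp))
      ((contMDiff_finsetSum fun j _ ↦ hf j).mdifferentiableAt (by simp))]
    rfl

theorem mlieBracket_sum_right {ι : Type*} (t : Finset ι) {X : ∀ x : M, TangentSpace I x}
    {Y : ι → ∀ x : M, TangentSpace I x} {x : M}
    (hY : ∀ i, ContMDiffAt I I.tangent ∞ (fun y ↦ (⟨y, Y i y⟩ : TangentBundle I M)) x) :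
    mlieBracket I X (fun y ↦ ∑ i ∈ t, Y i y) x = ∑ i ∈ t, mlieBracket I X (Y i) x := by
  classical
  have : CompleteSpace E := FiniteDimensional.complete ℝ E
  induction t using Finset.induction_on with
  | empty => exact mlieBracket_apply_eq_zero_of_eventuallyEq (.of_forall fun _ ↦ by simp)
  | insert i t hi ih =>
    simp only [Finset.sum_insert hi]
    rw [← ih]
    exact mlieBracket_add_right ((hY i).mdifferentiableAt (by simp))
      ((ContMDiffAt.sum_section fun j _ ↦ hY j).mdifferentiableAt (by simp))

end Gluing

section Data

variable {n : ℕ} {N : Type*} [TopologicalSpace N]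
  [ChartedSpace (EuclideanSpace ℝ (Fin n)) N] [IsManifold (𝓡 n) ∞ N]
  {M : Type*} [TopologicalSpace M] [ChartedSpace (EuclideanSpace ℝ (Fin (n + 1))) M]
  [IsManifold (𝓡 (n + 1)) ∞ M] {g : LorentzianMetric (n + 1) M}
  {φ : N → M} {ξ : ∀ p : N, TangentSpace (𝓡 (n + 1)) (φ p)}

omit [TopologicalSpace N] [ChartedSpace (EuclideanSpace ℝ (Fin n)) N] [IsManifold (𝓡 n) ∞ N] in
theorem IsExtension.mdifferentiableAt {X : ∀ p : N, TangentSpace (𝓡 (n + 1)) (φ p)} {W : Set M}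
    {η : ∀ x : M, TangentSpace (𝓡 (n + 1)) x} (hη : IsExtension φ X W η) (p : N) :
    MDifferentiableAt (𝓡 (n + 1)) (𝓡 (n + 1)).tangent
      (fun x ↦ (⟨x, η x⟩ : TangentBundle (𝓡 (n + 1)) M)) (φ p) :=
  (hη.smooth.contMDiffAt (hη.isOpen.mem_nhds (hη.range_subset ⟨p, rfl⟩))).mdifferentiableAt
    (by simp)

namespace MetricKTuple

variable {T : MetricKTuple n N} [NeZero n]

/-- An extension embeds the metric `K`-tuple if and only if its transverse derivative is the
prescribed one. -/
theorem isEmbeddedBy_iff (hT : T.IsSmooth) (h : T.data.IsEmbedded g φ ξ) {W : Set M}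
    {η : ∀ x : M, TangentSpace (𝓡 (n + 1)) x}
    (hη : IsExtension φ (fun p ↦ pushforward φ p (T.etaBar p)) W η) :
    T.IsEmbeddedBy g φ ξ W η ↔
      ∀ p : N, HasLieDerivAlong φ ξ η p (T.transverseDeriv φ ξ p) := by
  have hc := h.contMDiff.continuous
  have key : ∀ p Ξ, IsLocalExtension φ ξ p Ξ → _ := fun p Ξ hΞ ↦
    deformation_iff_mlieBracket hT h (hη.mdifferentiableAt p) (Filter.Eventually.of_forall hη.eq_on)
      hΞ.mdifferentiableAt (hΞ.eventually_eq hc.continuousAt)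
  constructor
  · intro he p
    exact ⟨h.exists_isLocalExtension p, fun Ξ hΞ ↦ (key p Ξ hΞ).1 ⟨he.mixed p, he.rigging p⟩⟩
  · intro he
    have hK := fun p ↦ (key p _ (he p).1.choose_spec).2 ((he p).2 _ (he p).1.choose_spec)
    exact ⟨h, hη, fun p ↦ deformation_tangent hT h (hη.mdifferentiableAt p)
      (Filter.Eventually.of_forall hη.eq_on), fun p ↦ (hK p).1, fun p ↦ (hK p).2⟩

variable [T2Space M] [SecondCountableTopology M]

/-- The local solutions of `exists_local_solution` glue: the derivatives of the functions of a
partition of unity along `ξ` multiply the common restriction `φ_* η̄` of the local solutions, and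
their sum vanishes. -/
theorem isEmbedded [Nonempty N] (hT : T.IsSmooth) (h : T.data.IsEmbedded g φ ξ) :
    T.IsEmbedded g φ ξ := by
  have hφc : Continuous φ := h.contMDiff.continuous
  have hloc : ∀ x : M, ∃ (W : Set M) (η : ∀ x : M, TangentSpace (𝓡 (n + 1)) x),
      x ∈ Set.range φ → IsOpen W ∧ x ∈ W ∧ 
        ContMDiffOn (𝓡 (n + 1)) (𝓡 (n + 1)).tangent ∞
          (fun x ↦ (⟨x, η x⟩ : TangentBundle (𝓡 (n + 1)) M)) W ∧
        (∀ q, φ q ∈ W → η (φ q) = pushforward φ q (T.etaBar q)) ∧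
        ∀ q, φ q ∈ W → ∀ Ξ, IsLocalExtension φ ξ q Ξ →
          mlieBracket (𝓡 (n + 1)) Ξ η (φ q) = T.transverseDeriv φ ξ q := fun x ↦ by
    by_cases hx : x ∈ Set.range φ
    · obtain ⟨p, rfl⟩ := hx
      obtain ⟨W, hW, hpW, η, hη⟩ := exists_local_solution hT h p
      exact ⟨W, η, fun _ ↦ ⟨hW, hpW, hη⟩⟩
    · exact ⟨∅, 0, fun h ↦ absurd h hx⟩
  choose U η₀ hUη using hloc
  obtain ⟨W, c, ρ, hW, hSW, hc, hρ, hρU, hρW⟩ := exists_smooth_partition_near (I := 𝓡 (n + 1))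
    (Set.range_nonempty φ) (U := U) fun x hx ↦ (hUη x hx).1.mem_nhds (hUη x hx).2.1
  let Y : ℕ → ∀ x : M, TangentSpace (𝓡 (n + 1)) x := fun i ↦ ρ i • η₀ (c i)
  have hY : ∀ i, ContMDiff (𝓡 (n + 1)) (𝓡 (n + 1)).tangent ∞
      (fun x ↦ (⟨x, Y i x⟩ : TangentBundle (𝓡 (n + 1)) M)) := fun i ↦
    ContMDiffOn.smul_section_of_tsupport (hρ i).contMDiffOn (hUη _ (hc i)).1 (hρU i)
      (hUη _ (hc i)).2.2.1
  let η : ∀ x : M, TangentSpace (𝓡 (n + 1)) x := fun x ↦ ∑ᶠ i, Y i x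
  have hηsum : ∀ x m, (∀ k, m ≤ k → ρ k x = 0) → η x = ∑ i ∈ Finset.range m, Y i x := by
    intro x m hm
    refine finsum_eq_sum_of_support_subset _ fun i hi ↦ ?_
    rw [Finset.coe_range, Set.mem_Iio]
    by_contra hmi
    exact hi (by simp [Y, hm i (not_lt.1 hmi)])
  have hYφ : ∀ i q, Y i (φ q) = ρ i (φ q) • pushforward φ q (T.etaBar q) := fun i q ↦ by
    by_cases hq : φ q ∈ U (c i)
    · simp [Y, (hUη _ (hc i)).2.2.2.1 q hq]
    · simp [Y, image_eq_zero_of_notMem_tsupport fun hq' ↦ hq (hρU i hq')]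
  have hYbr : ∀ i q Ξ, IsLocalExtension φ ξ q Ξ → mlieBracket (𝓡 (n + 1)) Ξ (Y i) (φ q) =
      mvfderiv (𝓡 (n + 1)) (ρ i) (φ q) (Ξ (φ q)) • pushforward φ q (T.etaBar q) +
        ρ i (φ q) • T.transverseDeriv φ ξ q := fun i q Ξ hΞ ↦ by
    by_cases hq : φ q ∈ U (c i)
    · obtain ⟨hU, -, hs, hv, hB⟩ := hUη _ (hc i)
      rw [mlieBracket_smul_right ((hρ i).mdifferentiableAt (by simp))
        ((hs.contMDiffAt (hU.mem_nhds hq)).mdifferentiableAt (by simp)), hv q hq, hB q hq Ξ hΞ]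
    · have h0 : ρ i =ᶠ[𝓝 (φ q)] 0 :=
        notMem_tsupport_iff_eventuallyEq.1 fun hq' ↦ hq (hρU i hq')
      rw [mlieBracket_apply_eq_zero_of_eventuallyEq (h0.mono fun y hy ↦ by
        change ρ i y • η₀ (c i) y = 0
        rw [hy, Pi.zero_apply, zero_smul]), h0.self_of_nhds,
        mvfderiv_apply_eq_zero_of_eventuallyEq_const h0]
      simp
  have hext : IsExtension φ (fun p ↦ pushforward φ p (T.etaBar p)) W η := by
    refine ⟨hW, hSW, fun x hx ↦ ?_, fun p ↦ ?_⟩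
    · obtain ⟨m, hm⟩ := hρW x hx
      have hs : ContMDiffAt (𝓡 (n + 1)) (𝓡 (n + 1)).tangent ∞
          (fun x ↦ (⟨x, ∑ i ∈ Finset.range m, Y i x⟩ : TangentBundle (𝓡 (n + 1)) M)) x :=
        ContMDiffAt.sum_section fun i _ ↦ hY i x
      refine (hs.congr_of_eventuallyEq ?_).contMDiffWithinAt
      filter_upwards [hm] with y hy
      rw [hηsum y m hy.1]
    · obtain ⟨m, hm⟩ := hρW _ (hSW ⟨p, rfl⟩)
      rw [hηsum _ m hm.self_of_nhds.1]
      simp only [hYφ]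
      rw [← Finset.sum_smul, hm.self_of_nhds.2, one_smul]
  refine ⟨W, η, (isEmbeddedBy_iff hT h hext).2 fun p ↦ ⟨h.exists_isLocalExtension p,
    fun Ξ hΞ ↦ ?_⟩⟩
  obtain ⟨m, hm⟩ := hρW _ (hSW ⟨p, rfl⟩)
  let Y' : ∀ x : M, TangentSpace (𝓡 (n + 1)) x := fun x ↦ ∑ i ∈ Finset.range m, Y i x
  have hη' : η =ᶠ[𝓝 (φ p)] Y' := hm.mono fun y hy ↦ hηsum y m hy.1
  have hd : ∑ i ∈ Finset.range m, mvfderiv (𝓡 (n + 1)) (ρ i) (φ p) (Ξ (φ p)) = 0 := by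
    rw [← mvfderiv_sum_apply _ hρ]
    exact mvfderiv_apply_eq_zero_of_eventuallyEq_const (hm.mono fun y hy ↦ hy.2) _
  rw [Filter.EventuallyEq.rfl.mlieBracket_vectorField_eq hη',
    mlieBracket_sum_right (X := Ξ) (Finset.range m) fun i ↦ hY i (φ p)]
  simp only [hYbr _ p Ξ hΞ]
  rw [Finset.sum_add_distrib, ← Finset.sum_smul, ← Finset.sum_smul, hd, hm.self_of_nhds.2,
    zero_smul, zero_add, one_smul]

/-- If the hypersurface is closed, an embedding extension can be cut off outside a neighbourhood of
it. -/
theorem exists_isEmbeddedBy_univ [Nonempty N] (hT : T.IsSmooth) (h : T.data.IsEmbedded g φ ξ)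
    (hcl : IsClosed (Set.range φ)) : ∃ η, T.IsEmbeddedBy g φ ξ Set.univ η := by
  obtain ⟨W, η, hη⟩ := isEmbedded hT h
  have : LocallyCompactSpace M :=
    ChartedSpace.locallyCompactSpace (EuclideanSpace ℝ (Fin (n + 1))) M
  obtain ⟨χ, hχ0, hχ1, -⟩ := exists_contMDiffMap_zero_one_nhds_of_isClosed (𝓡 (n + 1)) (n := ⊤)
    hη.extend.isOpen.isClosed_compl hcl
    (Set.disjoint_left.2 fun x hx hx' ↦ hx (hη.extend.range_subset hx'))
  have hev : ∀ p : N, (χ : M → ℝ) • η =ᶠ[𝓝 (φ p)] η := fun p ↦ by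
    filter_upwards [hχ1.filter_mono (nhds_le_nhdsSet (Set.mem_range_self p))] with x hx
    change χ x • η x = η x
    rw [hx, one_smul]
  have hsupp : tsupport (χ : M → ℝ) ⊆ W := fun x hx ↦ by
    by_contra hxW
    exact notMem_tsupport_iff_eventuallyEq.2 (hχ0.filter_mono (nhds_le_nhdsSet hxW)) hx
  refine ⟨(χ : M → ℝ) • η, (isEmbeddedBy_iff hT h
    ⟨isOpen_univ, Set.subset_univ _, ?_, fun p ↦ ?_⟩).2 fun p ↦
    ⟨h.exists_isLocalExtension p, fun Ξ hΞ ↦ ?_⟩⟩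
  · exact (ContMDiffOn.smul_section_of_tsupport χ.contMDiff.contMDiffOn hη.extend.isOpen hsupp
      hη.extend.smooth).contMDiffOn
  · rw [(hev p).self_of_nhds, hη.extend.eq_on]
  · rw [Filter.EventuallyEq.rfl.mlieBracket_vectorField_eq (hev p)]
    exact ((isEmbeddedBy_iff hT h hη.extend).1 hη p).2 Ξ hΞ

end MetricKTuple

end Data

/-! ### Gauge transformations -/

section Symm

variable {E : Type*} [NormedAddCommGroup E] [NormedSpace ℝ E] [FiniteDimensional ℝ E]
  {H : Type*} [TopologicalSpace H] {I : ModelWithCorners ℝ E H}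
  {M : Type*} [TopologicalSpace M] [ChartedSpace H M] [IsManifold I ∞ M]

theorem lieDeriv_symm {T : ∀ x : M, TangentSpace I x →L[ℝ] TangentSpace I x →L[ℝ] ℝ}
    (hT : IsSmoothTensor₂ I T) (hs : ∀ x v w, T x v w = T x w v)
    (X : ∀ x : M, TangentSpace I x) (x : M) (v w : TangentSpace I x) :
    lieDeriv X hT x v w = lieDeriv X hT x w v := by
  have hV := mdifferentiableAt_extend (I := I) v
  have hW := mdifferentiableAt_extend (I := I) w
  have e1 := lieDeriv_apply X hT hV hW
  have e2 := lieDeriv_apply X hT hW hV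
  rw [FiberBundle.extend_apply_self E v, FiberBundle.extend_apply_self E w] at e1 e2
  rw [e1, e2, hs x _ w, hs x v]
  simp only [hs _ (FiberBundle.extend E v _)]
  ring

end Symm

section Data

variable {n : ℕ} {N : Type*} [TopologicalSpace N]
  [ChartedSpace (EuclideanSpace ℝ (Fin n)) N] [IsManifold (𝓡 n) ∞ N]
  {M : Type*} [TopologicalSpace M] [ChartedSpace (EuclideanSpace ℝ (Fin (n + 1))) M]
  [IsManifold (𝓡 (n + 1)) ∞ M] {g : LorentzianMetric (n + 1) M}
  {φ : N → M} {ξ : ∀ p : N, TangentSpace (𝓡 (n + 1)) (φ p)} [NeZero n]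

theorem NullMetricData.gauge_nvec (D : NullMetricData n N) (G : GaugeParam n N) (p : N) :
    (D.gauge G).nvec p = (G.z p)⁻¹ • D.nvec p := by
  refine (D.gauge G).eq_nvec p (fun v ↦ ?_) ?_
  · simp [gauge]
  · simp [gauge, G.z_ne_zero p]

/-- `U ↦ z⁻¹ U`, because `n ↦ z⁻¹ n` and `γ(n,·) = 0`. -/
theorem NullMetricData.IsEmbedded.gauge_U {D : NullMetricData n N} (h : D.IsEmbedded g φ ξ)
    (G : GaugeParam n N) (p : N) (v w : TangentSpace (𝓡 n) p) :
    (D.gauge G).U p v w = (G.z p)⁻¹ * D.U p v w := by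
  have hz : ContMDiff (𝓡 n) 𝓘(ℝ) ∞ (fun q ↦ (G.z q)⁻¹) := fun q ↦
    ((contDiffAt_inv ℝ (G.z_ne_zero q)).contMDiffAt (n := ∞)).comp q (G.smooth_z q)
  have e := lieDeriv_smul D.smooth_γ (hz.mdifferentiableAt (by simp) (x := p))
    (h.isSmoothVectorField_nvec.mdifferentiableAt p) v w
  rw [D.γ_nvec, D.γ_nvec_right] at e
  have hn : (D.gauge G).nvec = fun q ↦ (G.z q)⁻¹ • D.nvec q := funext (D.gauge_nvec G)
  change (1 / 2 : ℝ) * lieDeriv (D.gauge G).nvec D.smooth_γ p v w =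
    _ * ((1 / 2 : ℝ) * lieDeriv D.nvec D.smooth_γ p v w)
  rw [hn, e]
  ring

omit [NeZero n] in
theorem NullMetricData.IsEmbedded.gauge {D : NullMetricData n N} (h : D.IsEmbedded g φ ξ)
    (G : GaugeParam n N) : (D.gauge G).IsEmbedded g φ (gaugeRigging φ ξ G) where
  embedding := h.embedding
  smooth_rigging := by
    rw [← contMDiffOn_univ]
    exact ((h.smoothAlongOn_rigging Set.univ).add
      (h.smoothAlongOn_pushforward G.smooth_V.contMDiffOn)).smul G.smooth_z.contMDiffOn
  transverse p v hv := by
    refine h.transverse p ((G.z p)⁻¹ • v - G.V p) ?_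
    rw [map_sub, map_smul, hv, gaugeRigging, inv_smul_smul₀ (G.z_ne_zero p), add_sub_cancel_right]
  pullback_γ := h.pullback_γ
  pullback_ell p v := by
    rw [gaugeRigging, map_smul, map_add, smul_apply, add_apply, h.pullback_ell, h.pullback_γ]
    rfl
  pullback_ell2 p := by
    simp only [gaugeRigging, map_smul, smul_apply, map_add, add_apply, h.pullback_ell2,
      h.pullback_ell, h.pullback_γ, g.symm _ (pushforward φ p _) (ξ p), smul_eq_mul,
      NullMetricData.gauge]
    ring

namespace MetricKTuple

variable {T : MetricKTuple n N}

theorem gauge_etaBar (G : GaugeParam n N) : (T.gauge G).etaBar = T.etaBar := by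
  funext p
  change (G.z p * T.α p) • (T.data.gauge G).nvec p = _
  rw [T.data.gauge_nvec, smul_smul, mul_comm (G.z p), mul_assoc, mul_inv_cancel₀ (G.z_ne_zero p),
    mul_one]
  rfl

/-- The gauge laws of `𝔮` and `𝔭` are those of the components of a fixed symmetric tensor, under
the change `ξ ↦ z (ξ + φ_* V)` of the rigging. -/
theorem IsEmbeddedBy.gauge {W : Set M} {η : ∀ x : M, TangentSpace (𝓡 (n + 1)) x}
    (h : T.IsEmbeddedBy g φ ξ W η) (G : GaugeParam n N) :
    (T.gauge G).IsEmbeddedBy g φ (gaugeRigging φ ξ G) W η where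
  data := h.data.gauge G
  extend := by
    rw [gauge_etaBar]
    exact h.extend
  tangent p v w := by
    rw [h.tangent]
    change _ = 2 * (G.z p * T.α p) * (T.data.gauge G).U p v w
    rw [h.data.gauge_U]
    have := G.z_ne_zero p
    field_simp
  mixed p v := by
    rw [gaugeRigging, map_smul, map_add, smul_apply, add_apply, h.mixed, h.tangent]
    rfl
  rigging p := by
    have hs : g.deformation η (φ p) (pushforward φ p (G.V p)) (ξ p) = T.q p (G.V p) :=
      (lieDeriv_symm g.smooth g.symm η (φ p) _ _).trans (h.mixed p _)
    simp only [gaugeRigging, map_smul, smul_apply, map_add, add_apply, h.rigging, h.mixed, hs,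
      h.tangent, smul_eq_mul, MetricKTuple.gauge]
    ring

end MetricKTuple

end Data

/-! ### Embeddedness of metric `K`-tuples -/

theorem proposition1 (n : ℕ) (hn : 2 ≤ n)
    {N : Type*} [TopologicalSpace N] [ChartedSpace (EuclideanSpace ℝ (Fin n)) N]
    [IsManifold (𝓡 n) ∞ N] [T2Space N] [SecondCountableTopology N] [ConnectedSpace N]
    {M : Type*} [TopologicalSpace M] [ChartedSpace (EuclideanSpace ℝ (Fin (n + 1))) M]
    [IsManifold (𝓡 (n + 1)) ∞ M] [T2Space M] [SecondCountableTopology M] [ConnectedSpace M]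
    (g : LorentzianMetric (n + 1) M)
    (T : MetricKTuple n N) (hT : T.IsSmooth)
    (φ : N → M) (ξ : ∀ p : N, TangentSpace (𝓡 (n + 1)) (φ p))
    (hemb : T.data.IsEmbedded g φ ξ) :
    -- the metric `K`-tuple can be embedded
    T.IsEmbedded g φ ξ ∧
    -- with an extension to all of `M` if the hypersurface is closed
    (IsClosed (Set.range φ) → ∃ η, T.IsEmbeddedBy g φ ξ Set.univ η) ∧
    -- an extension embeds the tuple iff its transverse derivative is the prescribed one
    (∀ W η, IsExtension φ (fun p ↦ pushforward φ p (T.etaBar p)) W η →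
      (T.IsEmbeddedBy g φ ξ W η ↔
        ∀ p : N, HasLieDerivAlong φ ξ η p (T.transverseDeriv φ ξ p))) ∧
    -- consistency with the gauge laws
    (∀ W η, T.IsEmbeddedBy g φ ξ W η →
      ∀ G : GaugeParam n N, (T.gauge G).IsEmbeddedBy g φ (gaugeRigging φ ξ G) W η) := by
  have : NeZero n := ⟨by omega⟩
  exact ⟨MetricKTuple.isEmbedded hT hemb, MetricKTuple.exists_isEmbeddedBy_univ hT hemb,
    fun W η hη ↦ MetricKTuple.isEmbeddedBy_iff hT hemb hη, fun W η h G ↦ h.gauge G⟩
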